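/- Let $G:[2,\infty)\to\mathbb R$ be defined by $G(2)=2$ and, for $0<x<\tfrac12$, $$G(1/x)=\frac{\gamma^2e^{\gamma}}{e^{\gamma}(\gamma-1)+1},\qquad\text{where } \gamma=\gamma(x)>0 \text{ is the unique positive solution of } x=\frac{e^{\gamma}(\gamma-1)+1}{(e^{\gamma}-1)^2};$$ it is part of the claim that this solution exists and is unique. Put $\gamma(1/2)=0$. Let $\|\cdot\|$ be an arbitrary norm on $\mathbb R^n$. Diameters and distances are measured in this norm. A Borel measure $\mu$ on $\mathbb R^n$ is log-concave if $\mu(tA+(1-t)B)\ge\mu(A)^t\mu(B)^{1-t}$ for all measurable $A,B$ and all $0<t<1$. For a measurable set $S$ put $\mu^+(S)=\liminf_{h\to0^+}\mu(S_h\setminus S)/h$, where $S_h$ is the set of points at distance at most $h$ from $S$. (i) Let $\mu$ be a log-concave probability measure supported on a convex body (a closed, bounded, convex set) $K\subset\mathbb R^n$. For every measurable $S\subset K$ with $\mu(S)\le\tfrac12$, $$(\operatorname{diam}K)\,\mu^+(S)\ \ge\ \mu(S)\,G(1/\mu(S)),$$ where the right-hand side is read as $0$ if $\mu(S)=0$.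 (ii) The bound is sharp for every $n\ge1$, every norm, every $x\in(0,\tfrac12]$ and every diameter $D>0$, the near-extremal examples being thin cylinders carrying an exponential density. Precisely: for every $n\ge 1$ and every norm on $\mathbb R^n$ there is a basis $b_1,\dots,b_n$ of $\mathbb R^n$ consisting of unit vectors such that for all $x\in(0,\tfrac12]$, $D>0$ and $\delta>0$ there are $\varepsilon\in(0,\delta)$, $L>0$ and $s\in(0,L)$ for which the following holds. Let $K=\{\sum_i z_ib_i:\ 0\le z_1\le L,\ 0\le z_i\le\varepsilon L \text{ for } i\ge2\}$, let $\mu$ be the probability measure on $K$ with density proportional to $e^{\gamma(x)z_1/L}$, and let $S=\{\sum_i z_ib_i\in K:\ z_1\le s\}$. Then $K$ is a convex body with nonempty interior, $\operatorname{diam}K=D$, $\mu$ is log-concave, $\mu(S)=x$, the limit $\mu^+(S)=\lim_{h\to0^+}\mu(S_h\setminus S)/h$ exists and is finite, and $D\,\mu^+(S)\le x\,G(1/x)+\delta$. -/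

import Mathlib

open MeasureTheory Filter Topology Set
open scoped Pointwise ENNReal

noncomputable section

/-- The parametrization `γ ↦ x = (e^γ (γ - 1) + 1) / (e^γ - 1)²`. -/
def isoParam (γ : ℝ) : ℝ :=
  (Real.exp γ * (γ - 1) + 1) / (Real.exp γ - 1) ^ 2

/-- The parameter belonging to `x ∈ (0, 1/2]`: the `γ > 0` with `isoParam γ = x` when `x < 1/2`
(the theorem asserts that it exists and is unique), and `γ = 0`, the limiting value, for
`x = 1/2`. -/
def isoGamma (x : ℝ) : ℝ :=
  if x = 1 / 2 then 0 else Function.invFunOn isoParam (Ioi 0) x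

/-- The function `G` on `[2, ∞)`: `G 2 = 2` and `G (1/x) = γ² e^γ / (e^γ (γ - 1) + 1)` for
`0 < x < 1/2`, where `γ` is the parameter belonging to `x`. -/
def isoG (y : ℝ) : ℝ :=
  if y = 2 then 2
  else isoGamma (1 / y) ^ 2 * Real.exp (isoGamma (1 / y)) /
    (Real.exp (isoGamma (1 / y)) * (isoGamma (1 / y) - 1) + 1)

section

variable {E : Type*} [NormedAddCommGroup E] [NormedSpace ℝ E] [MeasurableSpace E]

/-- Log-concavity of a measure: `μ (t A + (1 - t) B) ≥ μ(A)^t μ(B)^(1 - t)`. The endpoints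
`t = 0, 1` are omitted: there the inequality is trivial when `A` and `B` are nonempty. -/
def IsLogConcaveMeasure (μ : Measure E) : Prop :=
  ∀ A B : Set E, MeasurableSet A → MeasurableSet B → ∀ t ∈ Ioo (0 : ℝ) 1,
    μ A ^ t * μ B ^ (1 - t) ≤ μ (t • A + (1 - t) • B)

/-- `μ(S_h \ S) / h`, where `S_h` is the set of the points at distance at most `h` from `S`,
measured in the norm of `E`. -/
def minkowskiQuotient (μ : Measure E) (S : Set E) (h : ℝ) : ℝ≥0∞ :=
  μ (Metric.cthickening h S \ S) / ENNReal.ofReal h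

/-- The (lower) Minkowski measure `μ⁺(S)` with respect to the norm of `E`; it is the limit of
`μ(S_h \ S) / h` as `h → 0⁺` whenever that limit exists. -/
def minkowskiMeasure (μ : Measure E) (S : Set E) : ℝ≥0∞ :=
  liminf (minkowskiQuotient μ S) (𝓝[>] 0)

/-- The cylinder `[0, L] × [0, ε L]ⁿ` in the coordinates of the basis `b`. -/
def thinCylinder {n : ℕ} (b : Module.Basis (Fin (n + 1)) ℝ E) (L ε : ℝ) : Set E :=
  {z | b.repr z 0 ∈ Icc 0 L ∧ ∀ i, i ≠ 0 → b.repr z i ∈ Icc 0 (ε * L)}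

/-- The probability measure on the thin cylinder whose density with respect to Lebesgue measure
is proportional to `exp (γ z₀ / L)`, with `z₀` the coordinate along the axis. -/
def cylinderMeasure [BorelSpace E] {n : ℕ} (b : Module.Basis (Fin (n + 1)) ℝ E)
    (L ε γ : ℝ) : Measure E :=
  (b.addHaar.restrict (thinCylinder b L ε)).tilted (fun z => γ * b.repr z 0 / L)

/-- The part `[0, s] × [0, ε L]ⁿ` of the thin cylinder. -/
def cylinderSlice {n : ℕ} (b : Module.Basis (Fin (n + 1)) ℝ E) (L ε s : ℝ) : Set E :=
  {z ∈ thinCylinder b L ε | b.repr z 0 ≤ s}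

end

end

/-!
The function `x G(1/x)` is `min_γ γ (x + 1 / (e^γ - 1))`, the minimum over all exponential densities
`e^(γ z)` on `[0, 1]` of the boundary density at the quantile of order `x` (`mul_isoG_eq`,
`mul_isoG_le_exponential`; the derivative in `γ` is `x - isoParam γ`). The inequality says that, for
diameter one, no log-concave measure gives a set of measure `x` a smaller boundary measure.

The proof of the inequality works with enlargements by a fixed distance `r` and passes to the limit
`r → 0` only at the end. The counterpart of `x G(1/x)` at distance `r` is `profile k x`, the infimum
over `β ≥ 0` of `β x + 1 / (1 + β + ⋯ + β^(k-1))`, where `k r` is slightly more than the diameter.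

*On the line.* Log-concavity of `u ↦ ν (u, u + s]` makes the distribution function `F` after a shift
by `r` a concave function of `F` (`IsLogConcaveMeasure.cdf_cross`), so at a given point it has a
supporting line, `F (t + r) ≤ α + β F t` for all `t`. Iterating this `k` times leads from `F = 0` to
`F = 1` and gives `1 ≤ α (1 + β + ⋯ + β^(k-1))`, which is the claim for half-lines. Intervals are
treated in the same way (`profile_le_cdf_sub`), and general compact sets by splitting at gaps, since
`profile` is subadditive (`profile_le_cthickening_real`).

*Localization.* If the inequality failed for `S` in `K`, then `K` could be cut repeatedly by
hyperplanes that preserve the proportion of `S` on both sides, keeping each time a side on which the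
inequality fails (`IsBadBody.exists_halfspace`). Cutting through a dense sequence of flats of
codimension two forces the intersection into a line, so that some stage is as close to a segment
as desired (`IsBadBody.exists_thin`). There, the set enlarged by `h > r` contains the points that a
norming functional maps into the `r`-enlargement of the image of `S`, and the inequality on the line
gives a contradiction (`profile_le_cthickening`).

*Sharpness.* The first basis vector is a unit vector on which its coordinate functional, of norm
one, attains its norm. Enlarging the slice by `h` inside the cylinder then moves the cutting
hyperplane by exactly `h`, so that `μ⁺(S)` is the density of the exponential distribution on
`[0, L]` at its quantile, which is `x G(1/x) / L`. The diameter exceeds `L` by a factor of at most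
`1 + n ε`. That the cylinder measure is log-concave follows from the Prékopa–Leindler inequality
(`prekopa_leindler`).
-/

/-! ### The function `G` -/

lemma exp_mul_sub_one_add_one_pos {γ : ℝ} (h : γ ≠ 0) : 0 < Real.exp γ * (γ - 1) + 1 := by
  have h1 := Real.add_one_lt_exp (neg_ne_zero.2 h)
  have h2 := Real.exp_pos γ
  have h3 : Real.exp γ * Real.exp (-γ) = 1 := by rw [← Real.exp_add]; simp
  nlinarith

lemma hasDerivAt_exp_mul_sub_one (γ : ℝ) :
    HasDerivAt (fun γ => Real.exp γ * (γ - 1) + 1) (γ * Real.exp γ) γ := by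
  have h := ((Real.hasDerivAt_exp γ).mul ((hasDerivAt_id γ).sub_const 1)).add_const 1
  refine HasDerivAt.congr_deriv h ?_
  simp; ring

lemma exp_mul_sub_two_add_pos {γ : ℝ} (h : 0 < γ) : 0 < Real.exp γ * (γ - 2) + γ + 2 := by
  have hd : ∀ γ : ℝ, HasDerivAt (fun γ => Real.exp γ * (γ - 2) + γ + 2)
      (Real.exp γ * (γ - 1) + 1) γ := fun γ => by
    have h := (((Real.hasDerivAt_exp γ).mul ((hasDerivAt_id γ).sub_const 2)).add
      (hasDerivAt_id γ)).add_const 2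
    refine HasDerivAt.congr_deriv h ?_
    simp; ring
  have hm : StrictMonoOn (fun γ : ℝ => Real.exp γ * (γ - 2) + γ + 2) (Ici 0) := by
    apply strictMonoOn_of_deriv_pos (convex_Ici 0)
    · exact fun x _ => (hd x).continuousAt.continuousWithinAt
    · intro x hx
      rw [interior_Ici] at hx
      rw [(hd x).deriv]
      exact exp_mul_sub_one_add_one_pos (ne_of_gt hx)
  have := hm (by simp) (mem_Ici.2 h.le) h
  simpa using this

lemma hasDerivAt_isoParam {γ : ℝ} (h : 0 < γ) :
    HasDerivAt isoParam (-(Real.exp γ * (Real.exp γ * (γ - 2) + γ + 2)) / (Real.exp γ - 1) ^ 3)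
      γ := by
  have he : Real.exp γ - 1 ≠ 0 := by
    have := Real.add_one_lt_exp h.ne'; linarith
  have h1 := (hasDerivAt_exp_mul_sub_one γ).div (((Real.hasDerivAt_exp γ).sub_const 1).pow 2)
    (pow_ne_zero 2 he)
  refine HasDerivAt.congr_deriv h1 ?_
  simp only [Pi.pow_apply, Nat.cast_ofNat]
  field_simp
  ring

lemma strictAntiOn_isoParam : StrictAntiOn isoParam (Ioi 0) := by
  apply strictAntiOn_of_deriv_neg (convex_Ioi 0)
  · exact fun x hx => (hasDerivAt_isoParam hx).continuousAt.continuousWithinAt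
  · intro x hx
    rw [interior_Ioi] at hx
    rw [(hasDerivAt_isoParam hx).deriv]
    have h1 : 0 < Real.exp x - 1 := by
      have := Real.add_one_lt_exp (ne_of_gt hx); have := mem_Ioi.1 hx; linarith
    apply div_neg_of_neg_of_pos _ (by positivity)
    have := exp_mul_sub_two_add_pos hx
    have := Real.exp_pos x
    nlinarith

lemma isoParam_le_inv {γ : ℝ} (h : 0 < γ) : isoParam γ ≤ 1 / (1 + γ / 2) := by
  have h1 := Real.add_one_lt_exp h.ne'
  have h2 := Real.quadratic_le_exp_of_nonneg h.le
  have h3 : 0 < Real.exp γ - 1 := by linarith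
  unfold isoParam
  rw [div_le_div_iff₀ (by positivity) (by positivity)]
  have h4 : Real.exp γ * (γ - 1) + 1 ≤ γ * (Real.exp γ - 1) := by linarith
  have h5 : γ * (1 + γ / 2) ≤ Real.exp γ - 1 := by nlinarith
  calc _ ≤ γ * (Real.exp γ - 1) * (1 + γ / 2) := by gcongr
    _ = (Real.exp γ - 1) * (γ * (1 + γ / 2)) := by ring
    _ ≤ (Real.exp γ - 1) * (Real.exp γ - 1) := by gcongr
    _ = _ := by ring

lemma exp_sub_one_le_mul_exp (γ : ℝ) : Real.exp γ - 1 ≤ γ * Real.exp γ := by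
  have h1 := Real.add_one_le_exp (-γ)
  have h2 := Real.exp_pos γ
  have h3 : Real.exp γ * Real.exp (-γ) = 1 := by rw [← Real.exp_add]; simp
  nlinarith

lemma le_isoParam {γ : ℝ} (h : 0 < γ) : Real.exp (-(2 * γ)) / 2 ≤ isoParam γ := by
  have h1 := Real.add_one_lt_exp h.ne'
  have h3 : 0 < Real.exp γ - 1 := by linarith
  have h4 := exp_sub_one_le_mul_exp γ
  have h5 : γ ^ 2 / 2 ≤ Real.exp γ * (γ - 1) + 1 := by
    have hd : ∀ γ : ℝ, HasDerivAt (fun γ => Real.exp γ * (γ - 1) + 1 - γ ^ 2 / 2)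
        (γ * Real.exp γ - γ) γ := fun γ => by
      have h := (hasDerivAt_exp_mul_sub_one γ).sub (((hasDerivAt_id γ).pow 2).div_const 2)
      refine HasDerivAt.congr_deriv h ?_
      simp
    have hm : MonotoneOn (fun γ : ℝ => Real.exp γ * (γ - 1) + 1 - γ ^ 2 / 2) (Ici 0) := by
      apply monotoneOn_of_deriv_nonneg (convex_Ici 0)
      · exact fun x _ => (hd x).continuousAt.continuousWithinAt
      · exact fun x _ => (hd x).differentiableAt.differentiableWithinAt
      · intro x hx
        rw [interior_Ici] at hx
        rw [(hd x).deriv]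
        have := Real.add_one_le_exp x
        have := mem_Ioi.1 hx
        nlinarith
    have := hm (by simp) (mem_Ici.2 h.le) h.le
    simp at this
    linarith
  unfold isoParam
  rw [div_le_div_iff₀ (by positivity) (by positivity)]
  have h6 : Real.exp (-(2 * γ)) * (Real.exp γ) ^ 2 = 1 := by
    rw [← Real.exp_nat_mul, ← Real.exp_add]; simp
  calc Real.exp (-(2 * γ)) * (Real.exp γ - 1) ^ 2
      ≤ Real.exp (-(2 * γ)) * (γ * Real.exp γ) ^ 2 := by gcongr
    _ = γ ^ 2 * (Real.exp (-(2 * γ)) * (Real.exp γ) ^ 2) := by ring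
    _ = γ ^ 2 := by rw [h6, mul_one]
    _ ≤ _ := by linarith

lemma exists_isoParam_eq {x : ℝ} (hx : x ∈ Ioo (0 : ℝ) (1 / 2)) : ∃ γ > 0, isoParam γ = x := by
  obtain ⟨hx0, hx1⟩ := hx
  have hlow : ∃ a > 0, x < isoParam a := by
    have ht : Tendsto (fun γ : ℝ => Real.exp (-(2 * γ)) / 2) (𝓝[>] 0) (𝓝 (1 / 2)) := by
      have : Continuous fun γ : ℝ => Real.exp (-(2 * γ)) / 2 := by fun_prop
      simpa using (this.tendsto 0).mono_left nhdsWithin_le_nhds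
    obtain ⟨a, ha, ha0⟩ := ((ht.eventually (lt_mem_nhds hx1)).and self_mem_nhdsWithin).exists
    exact ⟨a, ha0, ha.trans_le (le_isoParam ha0)⟩
  obtain ⟨a, ha, hax⟩ := hlow
  have hb : 0 < 2 / x := by positivity
  have hbx : isoParam (2 / x) < x := by
    refine (isoParam_le_inv hb).trans_lt ?_
    rw [div_lt_iff₀ (by positivity)]
    field_simp
    linarith
  have hc : ContinuousOn isoParam (uIcc a (2 / x)) := fun y hy => by
    have : 0 < y := lt_of_lt_of_le (lt_min ha hb) hy.1
    exact (hasDerivAt_isoParam this).continuousAt.continuousWithinAt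
  obtain ⟨γ, hγ, h⟩ := intermediate_value_uIcc hc (show x ∈ _ from by
    rw [uIcc_of_ge (hbx.trans hax).le]; exact ⟨hbx.le, hax.le⟩)
  exact ⟨γ, lt_of_lt_of_le (lt_min ha hb) hγ.1, h⟩

lemma isoGamma_spec {x : ℝ} (hx : x ∈ Ioo (0 : ℝ) (1 / 2)) :
    0 < isoGamma x ∧ isoParam (isoGamma x) = x := by
  have h : ∃ a ∈ Ioi (0 : ℝ), isoParam a = x := exists_isoParam_eq hx
  unfold isoGamma
  rw [if_neg hx.2.ne]
  exact ⟨Function.invFunOn_mem h, Function.invFunOn_eq h⟩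

lemma half_mul_isoG : (1 / 2 : ℝ) * isoG (1 / (1 / 2)) = 1 := by
  rw [isoG, if_pos (by norm_num)]; norm_num

/-- On `(0, 1/2)`, `x G(1/x)` is the boundary density of the exponential distribution on `[0, 1]`
with parameter `γ(x)` at its quantile of order `x`. -/
lemma mul_isoG_eq {x : ℝ} (hx : x ∈ Ioo (0 : ℝ) (1 / 2)) :
    x * isoG (1 / x) = isoGamma x * (x + 1 / (Real.exp (isoGamma x) - 1)) := by
  obtain ⟨hγ, hp⟩ := isoGamma_spec hx
  have hx0 := hx.1
  have hne : (1 / x : ℝ) ≠ 2 := by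
    intro h
    have : x = 1 / 2 := by field_simp at h; linarith
    exact hx.2.ne this
  rw [isoG, if_neg hne, one_div_one_div]
  set γ := isoGamma x with hγd
  have h1 : 0 < Real.exp γ - 1 := by
    have := Real.add_one_lt_exp hγ.ne'; linarith
  have h2 := exp_mul_sub_one_add_one_pos hγ.ne'
  rw [← hp, isoParam]
  field_simp
  ring

lemma mul_isoG_le_exponential {x : ℝ} (hx : x ∈ Ioc (0 : ℝ) (1 / 2)) {γ : ℝ} (hγ : 0 < γ) :
    x * isoG (1 / x) ≤ γ * (x + 1 / (Real.exp γ - 1)) := by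
  rcases hx.2.lt_or_eq with hlt | rfl
  · have hx' : x ∈ Ioo (0 : ℝ) (1 / 2) := ⟨hx.1, hlt⟩
    rw [mul_isoG_eq hx']
    obtain ⟨hg, hp⟩ := isoGamma_spec hx'
    set g := isoGamma x
    -- The derivative in `γ` of the right-hand side is `x - isoParam γ`, which changes sign at `g`.
    have hd : ∀ γ : ℝ, 0 < γ → HasDerivAt (fun γ => γ * (x + 1 / (Real.exp γ - 1)))
        (x - isoParam γ) γ := fun γ hγ => by
      have h1 : Real.exp γ - 1 ≠ 0 := by
        have := Real.add_one_lt_exp hγ.ne'; linarith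
      have h := (hasDerivAt_id γ).mul ((((hasDerivAt_const γ (1 : ℝ)).div
        ((Real.hasDerivAt_exp γ).sub_const 1) h1)).const_add x)
      refine HasDerivAt.congr_deriv h ?_
      simp only [isoParam, Pi.div_apply, id]
      field_simp
      ring
    rcases le_total γ g with h | h
    · have hm : AntitoneOn (fun γ => γ * (x + 1 / (Real.exp γ - 1))) (Icc γ g) := by
        apply antitoneOn_of_deriv_nonpos (convex_Icc _ _)
        · exact fun y hy => (hd y (hγ.trans_le hy.1)).continuousAt.continuousWithinAt
        · intro y hy
          rw [interior_Icc] at hy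
          exact (hd y (hγ.trans hy.1)).differentiableAt.differentiableWithinAt
        · intro y hy
          rw [interior_Icc] at hy
          rw [(hd y (hγ.trans hy.1)).deriv]
          have := strictAntiOn_isoParam (hγ.trans hy.1) hg hy.2
          linarith
      exact hm (left_mem_Icc.2 h) (right_mem_Icc.2 h) h
    · have hm : MonotoneOn (fun γ => γ * (x + 1 / (Real.exp γ - 1))) (Icc g γ) := by
        apply monotoneOn_of_deriv_nonneg (convex_Icc _ _)
        · exact fun y hy => (hd y (hg.trans_le hy.1)).continuousAt.continuousWithinAt
        · intro y hy
          rw [interior_Icc] at hy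
          exact (hd y (hg.trans hy.1)).differentiableAt.differentiableWithinAt
        · intro y hy
          rw [interior_Icc] at hy
          rw [(hd y (hg.trans hy.1)).deriv]
          have := strictAntiOn_isoParam hg (hg.trans hy.1) hy.1
          linarith
      exact hm (left_mem_Icc.2 h) (right_mem_Icc.2 h) h
  · rw [half_mul_isoG]
    have h1 : 0 < Real.exp γ - 1 := by
      have := Real.add_one_lt_exp hγ.ne'; linarith
    have h2 := exp_mul_sub_two_add_pos hγ
    have : γ * (1 / 2 + 1 / (Real.exp γ - 1)) = γ * (Real.exp γ + 1) / (2 * (Real.exp γ - 1)) := by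
      field_simp; ring
    rw [this, le_div_iff₀ (by positivity)]
    linarith

lemma mul_isoG_nonneg {x : ℝ} (hx : x ∈ Ioc (0 : ℝ) (1 / 2)) : 0 ≤ x * isoG (1 / x) := by
  rcases hx.2.lt_or_eq with hlt | rfl
  · rw [mul_isoG_eq ⟨hx.1, hlt⟩]
    have hg := (isoGamma_spec ⟨hx.1, hlt⟩).1
    have h1 := Real.add_one_lt_exp hg.ne'
    have h2 : 0 ≤ 1 / (Real.exp (isoGamma x) - 1) := one_div_nonneg.2 (by linarith)
    exact mul_nonneg hg.le (add_nonneg hx.1.le h2)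
  · rw [half_mul_isoG]; norm_num

lemma mul_isoG_le_one {x : ℝ} (hx : x ∈ Ioc (0 : ℝ) (1 / 2)) : x * isoG (1 / x) ≤ 1 := by
  -- Let `γ → 0` in `γ (x + 1 / (e^γ - 1)) ≤ γ x + 1`.
  have ht : Tendsto (fun γ : ℝ => γ * x + 1) (𝓝[>] 0) (𝓝 1) := by
    have : Continuous fun γ : ℝ => γ * x + 1 := by fun_prop
    simpa using (this.tendsto 0).mono_left nhdsWithin_le_nhds
  refine ge_of_tendsto ht ?_
  filter_upwards [self_mem_nhdsWithin] with γ hγ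
  have hγ : 0 < γ := hγ
  refine (mul_isoG_le_exponential hx hγ).trans ?_
  have h1 := Real.add_one_lt_exp hγ.ne'
  rw [mul_add]
  gcongr
  rw [mul_one_div, div_le_one (by linarith)]
  linarith

/-! ### The discrete isoperimetric profile -/

/-- A lower bound for the measure of the `r`-enlargement of a set of measure `x`, under
log-concave probability measures on an interval of length less than `k r`. The affine function with
parameter `β = e^(γ / k)` gives the measure of an enlarged half-line under the exponential
distribution with parameter `γ` on an interval of length `k r`; at `β = 0` it is the trivial value
`1`, because `0 ^ 0 = 1`. -/
noncomputable def profile (k : ℕ) (x : ℝ) : ℝ :=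
  ⨅ β : Ici (0 : ℝ), ((β : ℝ) * x + (∑ j ∈ Finset.range k, (β : ℝ) ^ j)⁻¹)

lemma inv_geom_sum_nonneg (k : ℕ) {β : ℝ} (hβ : 0 ≤ β) :
    0 ≤ (∑ j ∈ Finset.range k, β ^ j)⁻¹ :=
  inv_nonneg.2 (Finset.sum_nonneg fun _ _ => pow_nonneg hβ _)

lemma profile_le (k : ℕ) {x β : ℝ} (hx : 0 ≤ x) (hβ : 0 ≤ β) :
    profile k x ≤ β * x + (∑ j ∈ Finset.range k, β ^ j)⁻¹ :=
  ciInf_le (f := fun β : Ici (0 : ℝ) => ((β : ℝ) * x + (∑ j ∈ Finset.range k, (β : ℝ) ^ j)⁻¹))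
    ⟨0, by
      rintro _ ⟨β, rfl⟩
      exact add_nonneg (mul_nonneg β.2 hx) (inv_geom_sum_nonneg k β.2)⟩ ⟨β, hβ⟩

lemma le_profile {k : ℕ} {x c : ℝ}
    (h : ∀ β : ℝ, 0 ≤ β → c ≤ β * x + (∑ j ∈ Finset.range k, β ^ j)⁻¹) : c ≤ profile k x :=
  le_ciInf fun β => h β β.2

lemma profile_nonneg (k : ℕ) {x : ℝ} (hx : 0 ≤ x) : 0 ≤ profile k x :=
  le_profile fun _ hβ => add_nonneg (mul_nonneg hβ hx) (inv_geom_sum_nonneg k hβ)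

lemma profile_mono (k : ℕ) {x y : ℝ} (hx : 0 ≤ x) (hxy : x ≤ y) : profile k x ≤ profile k y :=
  le_profile fun β hβ => (profile_le k hx hβ).trans (by gcongr)

lemma profile_zero_le {k : ℕ} (hk : 2 ≤ k) : profile k 0 ≤ 0 := by
  refine le_of_forall_pos_le_add fun ε hε => ?_
  have hβ : (0 : ℝ) < ε⁻¹ := by positivity
  refine (profile_le k le_rfl hβ.le).trans ?_
  rw [mul_zero, zero_add, zero_add]
  have h : ε⁻¹ ≤ ∑ j ∈ Finset.range k, ε⁻¹ ^ j := by
    have := Finset.single_le_sum (f := fun j => ε⁻¹ ^ j) (fun j _ => pow_nonneg hβ.le j)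
      (Finset.mem_range.2 (show 1 < k by omega))
    simpa using this
  exact inv_le_of_inv_le₀ hε h

lemma profile_scale (k : ℕ) {x y : ℝ} (hx : 0 ≤ x) (hy : 0 < y) (hxy : x ≤ y) :
    x / y * profile k y ≤ profile k x := by
  refine le_profile fun β hβ => ?_
  calc x / y * profile k y ≤ x / y * (β * y + (∑ j ∈ Finset.range k, β ^ j)⁻¹) := by
        gcongr; exact profile_le k hy.le hβ
    _ = β * x + x / y * (∑ j ∈ Finset.range k, β ^ j)⁻¹ := by field_simp
    _ ≤ _ := by
        gcongr
        exact mul_le_of_le_one_left (inv_geom_sum_nonneg k hβ) ((div_le_one hy).2 hxy)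

lemma profile_add_le (k : ℕ) {x y : ℝ} (hx : 0 ≤ x) (hy : 0 ≤ y) :
    profile k (x + y) ≤ profile k x + profile k y := by
  rcases (add_nonneg hx hy).eq_or_lt with h | h
  · have : x = 0 ∧ y = 0 := ⟨by linarith, by linarith⟩
    rw [this.1, this.2, add_zero]
    linarith [profile_nonneg k (le_refl (0 : ℝ))]
  · have h1 := profile_scale k hx h (by linarith)
    have h2 := profile_scale k hy h (by linarith)
    have : x / (x + y) * profile k (x + y) + y / (x + y) * profile k (x + y)
        = profile k (x + y) := by field_simp
    linarith

/-- If `J` is at most the boundary density at mass `x` of every exponential distribution with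
parameter `γ ≥ 0`, then the discrete profile grows at rate `J`, up to a factor tending to `1`. -/
lemma add_le_profile {k : ℕ} (hk : 2 ≤ k) {x J : ℝ} (hx : x ∈ Ioc (0 : ℝ) (1 / 2)) (hJ0 : 0 ≤ J)
    (hJ1 : J ≤ 1) (hJ : ∀ γ > 0, J ≤ γ * (x + 1 / (Real.exp γ - 1))) :
    x + Real.exp (-(2 / k)) * J / k ≤ profile k x := by
  have hk0 : (0 : ℝ) < k := by positivity
  have hk2 : (2 : ℝ) ≤ k := by exact_mod_cast hk
  have he1 : Real.exp (-(2 / (k : ℝ))) ≤ 1 := Real.exp_le_one_iff.2 (by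
    have : 0 ≤ 2 / (k : ℝ) := by positivity
    linarith)
  have hJk : Real.exp (-(2 / (k : ℝ))) * J / k ≤ J / k := by
    gcongr; exact mul_le_of_le_one_left hJ0 he1
  refine le_profile fun β hβ => ?_
  rcases hβ.eq_or_lt with rfl | hβ
  · have h1 : ∑ j ∈ Finset.range k, (0 : ℝ) ^ j = 1 := by
      obtain ⟨m, rfl⟩ := Nat.exists_eq_succ_of_ne_zero (by omega : k ≠ 0)
      simp [Finset.sum_range_succ']
    have h2 : J / k ≤ 1 / 2 := by
      rw [div_le_div_iff₀ hk0 (by norm_num)]; linarith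
    have := hx.2
    rw [h1]; norm_num at *; linarith
  rcases eq_or_ne β 1 with rfl | hne
  · have h2 : J / k ≤ (k : ℝ)⁻¹ := by
      rw [div_eq_mul_inv]; exact mul_le_of_le_one_left (by positivity) hJ1
    simp only [one_mul, one_pow, Finset.sum_const, Finset.card_range, nsmul_eq_mul, mul_one]
    linarith
  rw [geom_sum_eq hne, inv_div]
  set u := Real.log β with hu
  have hβu : β = Real.exp u := (Real.exp_log hβ).symm
  have hpow : β ^ k = Real.exp (k * u) := by rw [hβu, ← Real.exp_nat_mul]
  rw [hpow]
  rcases hne.lt_or_gt with hlt | hgt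
  · -- Reflecting the interval turns `u < 0` into `-u > 0` and `x` into `1 - x ≥ x`.
    have hu0 : 0 < -u := by have := Real.log_neg hβ hlt; linarith
    have hγ : 0 < k * -u := by positivity
    have h1 : 0 < Real.exp (k * -u) - 1 := by
      have := Real.add_one_lt_exp hγ.ne'; linarith
    have h2 : Real.exp (k * u) = (Real.exp (k * -u))⁻¹ := by rw [← Real.exp_neg]; ring_nf
    have key : β * x + (β - 1) / (Real.exp (k * u) - 1)
        = x + (1 - β) * ((1 - x) + 1 / (Real.exp (k * -u) - 1)) := by
      rw [h2]
      set e := Real.exp (k * -u)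
      have he : (0 : ℝ) < e := by linarith
      have : e⁻¹ - 1 = -((e - 1) / e) := by field_simp; ring
      rw [this, div_neg, div_div_eq_mul_div]
      field_simp
      ring
    rw [key]
    gcongr
    have h3 : 0 ≤ 1 / (Real.exp (k * -u) - 1) := by positivity
    have hx2 := hx.2
    rcases le_total (k * -u) 2 with hle | hge
    · have h4 : -u * Real.exp (-(2 / (k : ℝ))) ≤ 1 - β := by
        have h5 := exp_sub_one_le_mul_exp u
        have h6 : Real.exp (-(2 / (k : ℝ))) ≤ Real.exp u := Real.exp_le_exp.2 (by
          have : -u ≤ 2 / k := by rw [le_div_iff₀ hk0]; linarith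
          linarith)
        rw [hβu]
        nlinarith
      have h5 := hJ _ hγ
      calc Real.exp (-(2 / (k : ℝ))) * J / k
          ≤ Real.exp (-(2 / (k : ℝ))) * (k * -u * (x + 1 / (Real.exp (k * -u) - 1))) / k := by
            gcongr
        _ = (-u * Real.exp (-(2 / (k : ℝ)))) * (x + 1 / (Real.exp (k * -u) - 1)) := by
            field_simp
        _ ≤ (1 - β) * ((1 - x) + 1 / (Real.exp (k * -u) - 1)) := by
            have := hx.1
            gcongr
            linarith
    · have h4 : 2 / k * Real.exp (-(2 / (k : ℝ))) ≤ 1 - β := by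
        have h5 := exp_sub_one_le_mul_exp (-(2 / (k : ℝ)))
        have h6 : Real.exp u ≤ Real.exp (-(2 / (k : ℝ))) := Real.exp_le_exp.2 (by
          have : 2 / k ≤ -u := by rw [div_le_iff₀ hk0]; linarith
          linarith)
        rw [hβu]
        nlinarith
      calc Real.exp (-(2 / (k : ℝ))) * J / k ≤ Real.exp (-(2 / (k : ℝ))) * 1 / k := by gcongr
        _ = (2 / k * Real.exp (-(2 / (k : ℝ)))) * (1 / 2) := by ring
        _ ≤ (1 - β) * ((1 - x) + 1 / (Real.exp (k * -u) - 1)) := by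
            gcongr
            linarith
  · have hu0 : 0 < u := Real.log_pos hgt
    have hγ : 0 < k * u := by positivity
    have h1 : 0 < Real.exp (k * u) - 1 := by
      have := Real.add_one_lt_exp hγ.ne'; linarith
    have h4 : u ≤ β - 1 := by have := Real.add_one_le_exp u; rw [hβu]; linarith
    have h5 := hJ _ hγ
    have hx0 := hx.1
    calc x + Real.exp (-(2 / (k : ℝ))) * J / k ≤ x + J / k := by linarith
      _ ≤ x + (k * u * (x + 1 / (Real.exp (k * u) - 1))) / k := by gcongr
      _ = x + u * (x + 1 / (Real.exp (k * u) - 1)) := by field_simp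
      _ ≤ x + (β - 1) * (x + 1 / (Real.exp (k * u) - 1)) := by gcongr
      _ = _ := by ring

/-! ### Log-concave measures on the line -/

lemma IsLogConcaveMeasure.real_le {E : Type*} [NormedAddCommGroup E] [NormedSpace ℝ E]
    [MeasurableSpace E] {μ : Measure E} [IsFiniteMeasure μ] (hμ : IsLogConcaveMeasure μ)
    {A B C : Set E} (hA : MeasurableSet A) (hB : MeasurableSet B) {t : ℝ} (ht : t ∈ Ioo (0 : ℝ) 1)
    (hC : t • A + (1 - t) • B ⊆ C) : μ.real A ^ t * μ.real B ^ (1 - t) ≤ μ.real C := by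
  have h := (hμ A B hA hB t ht).trans (measure_mono hC)
  have h2 := ENNReal.toReal_mono (measure_ne_top μ C) h
  rwa [ENNReal.toReal_mul, ← ENNReal.toReal_rpow, ← ENNReal.toReal_rpow] at h2

lemma smul_Ioc_add_smul_Ioc_subset {t u w s : ℝ} (ht : t ∈ Ioo (0 : ℝ) 1) :
    t • Ioc u (u + s) + (1 - t) • Ioc w (w + s) ⊆
      Ioc (t * u + (1 - t) * w) (t * u + (1 - t) * w + s) := by
  rintro _ ⟨_, ⟨x, hx, rfl⟩, _, ⟨y, hy, rfl⟩, rfl⟩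
  obtain ⟨h0, h1⟩ := ht
  simp only [smul_eq_mul, mem_Ioc] at *
  constructor <;> nlinarith

lemma IsLogConcaveMeasure.Ioc_mul_Ioc_le {ν : Measure ℝ} [IsFiniteMeasure ν]
    (hν : IsLogConcaveMeasure ν) {u w r s : ℝ} (huw : u ≤ w) (hr : 0 < r) :
    ν.real (Ioc u (u + s)) * ν.real (Ioc (w + r) (w + r + s)) ≤
      ν.real (Ioc (u + r) (u + r + s)) * ν.real (Ioc w (w + s)) := by
  rcases huw.eq_or_lt with rfl | huw
  · rw [mul_comm]
  -- `u + r` and `w` are complementary convex combinations of `u` and `w + r`.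
  set l := r / (w + r - u) with hl
  have hd : 0 < w + r - u := by linarith
  have hl0 : 0 < l := by positivity
  have hl1 : l < 1 := by rw [hl, div_lt_one hd]; linarith
  have hlr : l * (w + r - u) = r := by rw [hl]; field_simp
  set P := ν.real (Ioc u (u + s))
  set Q := ν.real (Ioc (w + r) (w + r + s))
  have e1 : (1 - l) * u + (1 - (1 - l)) * (w + r) = u + r := by linear_combination hlr
  have e2 : l * u + (1 - l) * (w + r) = w := by linear_combination -hlr
  have h1 : P ^ (1 - l) * Q ^ (1 - (1 - l)) ≤ ν.real (Ioc (u + r) (u + r + s)) := by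
    have ht : 1 - l ∈ Ioo (0 : ℝ) 1 := ⟨by linarith, by linarith⟩
    refine hν.real_le measurableSet_Ioc measurableSet_Ioc ht ?_
    have := smul_Ioc_add_smul_Ioc_subset (u := u) (w := w + r) (s := s) ht
    rwa [e1] at this
  have h2 : P ^ l * Q ^ (1 - l) ≤ ν.real (Ioc w (w + s)) := by
    have ht : l ∈ Ioo (0 : ℝ) 1 := ⟨hl0, hl1⟩
    refine hν.real_le measurableSet_Ioc measurableSet_Ioc ht ?_
    have := smul_Ioc_add_smul_Ioc_subset (u := u) (w := w + r) (s := s) ht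
    rwa [e2] at this
  have hP : 0 ≤ P := measureReal_nonneg
  have hQ : 0 ≤ Q := measureReal_nonneg
  calc P * Q = (P ^ (1 - l) * Q ^ (1 - (1 - l))) * (P ^ l * Q ^ (1 - l)) := by
        have a1 : P ^ (1 - l) * P ^ l = P := by
          rw [← Real.rpow_add' hP (by norm_num)]; simp
        have a2 : Q ^ (1 - (1 - l)) * Q ^ (1 - l) = Q := by
          rw [← Real.rpow_add' hQ (by norm_num)]; simp
        calc P * Q = (P ^ (1 - l) * P ^ l) * (Q ^ (1 - (1 - l)) * Q ^ (1 - l)) := by rw [a1, a2]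
          _ = _ := by ring
    _ ≤ _ := by gcongr

lemma measureReal_Ioc_eq_sum (ν : Measure ℝ) [IsFiniteMeasure ν] (b : ℝ) {s : ℝ} (hs : 0 ≤ s)
    (N : ℕ) : ν.real (Ioc b (b + N * s)) =
      ∑ i ∈ Finset.range N, ν.real (Ioc (b + i * s) (b + i * s + s)) := by
  induction N with
  | zero => simp
  | succ N ih =>
    rw [Finset.sum_range_succ, ← ih, ← measureReal_union]
    · congr 1
      have h : (0 : ℝ) ≤ N * s := by positivity
      rw [Ioc_union_Ioc_eq_Ioc (by linarith) (by linarith)]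
      push_cast; ring_nf
    · exact Ioc_disjoint_Ioc_of_le le_rfl
    · exact measurableSet_Ioc

/-- The relative growth of the distribution function `F` under a shift is smaller further to the
right. For adjacent intervals divided into cells of equal length this is log-concavity of
`u ↦ ν (u, u + s]`; the general case follows from right-continuity of `F`. -/
lemma IsLogConcaveMeasure.cdf_cross {ν : Measure ℝ} [IsProbabilityMeasure ν]
    (hν : IsLogConcaveMeasure ν) {t b t' r : ℝ} (htb : t ≤ b) (hbt : b ≤ t') (hr : 0 < r) :
    (ProbabilityTheory.cdf ν b - ProbabilityTheory.cdf ν t) *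
        (ProbabilityTheory.cdf ν (t' + r) - ProbabilityTheory.cdf ν (b + r)) ≤
      (ProbabilityTheory.cdf ν (b + r) - ProbabilityTheory.cdf ν (t + r)) *
        (ProbabilityTheory.cdf ν t' - ProbabilityTheory.cdf ν b) := by
  set F := ProbabilityTheory.cdf ν with hF
  have hI : ∀ {a c : ℝ}, a ≤ c → ν.real (Ioc a c) = F c - F a := fun {a c} hac => by
    rw [hF, ProbabilityTheory.cdf_eq_real, ProbabilityTheory.cdf_eq_real,
      show Ioc a c = Iic c \ Iic a by ext; simp [and_comm],
      measureReal_sdiff (Iic_subset_Iic.2 hac) measurableSet_Iic]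
  rcases htb.eq_or_lt with rfl | htb
  · simp
  have key : ∀ N : ℕ, (F b - F t) * (F (t' + r) - F (b + r)) ≤
      (F (b + r) - F (t + r)) * (F (t' + (b - t) / (N + 1)) - F b) := fun N => by
    set s := (b - t) / (N + 1) with hs
    have hs0 : 0 < s := by have : 0 < b - t := by linarith
                           positivity
    have hsN : ((N + 1 : ℕ) : ℝ) * s = b - t := by push_cast; rw [hs]; field_simp
    set M := ⌈(t' - b) / s⌉₊
    have hM1 : t' - b ≤ M * s := (div_le_iff₀ hs0).1 (Nat.le_ceil _)
    have hM2 : M * s ≤ t' - b + s := by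
      have := (Nat.ceil_lt_add_one (show 0 ≤ (t' - b) / s from
        div_nonneg (by linarith) hs0.le)).le
      calc M * s ≤ ((t' - b) / s + 1) * s := by gcongr
        _ = _ := by field_simp
    have hMs : 0 ≤ M * s := by positivity
    have e1 := measureReal_Ioc_eq_sum ν t hs0.le (N + 1)
    have e2 := measureReal_Ioc_eq_sum ν (t + r) hs0.le (N + 1)
    have e3 := measureReal_Ioc_eq_sum ν b hs0.le M
    have e4 := measureReal_Ioc_eq_sum ν (b + r) hs0.le M
    rw [hsN] at e1 e2
    rw [show t + (b - t) = b by ring, hI htb.le] at e1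
    rw [show t + r + (b - t) = b + r by ring, hI (by linarith)] at e2
    rw [hI (by linarith)] at e3 e4
    have hcell : (F b - F t) * (F (b + r + M * s) - F (b + r)) ≤
        (F (b + r) - F (t + r)) * (F (b + M * s) - F b) := by
      rw [e1, e2, e3, e4, Finset.sum_mul_sum, Finset.sum_mul_sum]
      refine Finset.sum_le_sum fun i hi => Finset.sum_le_sum fun j _ => ?_
      have hi' : (i : ℝ) + 1 ≤ (N + 1 : ℕ) := by exact_mod_cast Finset.mem_range.1 hi
      have hij : t + i * s ≤ b + j * s := by
        have h1 : (0 : ℝ) ≤ j * s := by positivity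
        have h2 : ((i : ℝ) + 1) * s ≤ (N + 1 : ℕ) * s := by gcongr
        linarith
      have := hν.Ioc_mul_Ioc_le (s := s) hij hr
      rwa [show t + i * s + r = t + r + i * s by ring,
        show b + j * s + r = b + r + j * s by ring] at this
    have m1 : F (t' + r) ≤ F (b + r + M * s) := F.mono (by linarith)
    have m2 : F (b + M * s) ≤ F (t' + s) := F.mono (by linarith)
    have m3 : 0 ≤ F b - F t := sub_nonneg.2 (F.mono htb.le)
    have m4 : 0 ≤ F (b + r) - F (t + r) := sub_nonneg.2 (F.mono (by linarith))
    calc _ ≤ (F b - F t) * (F (b + r + M * s) - F (b + r)) := by gcongr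
      _ ≤ _ := hcell
      _ ≤ _ := by gcongr
  have hlim : Tendsto (fun N : ℕ => F (t' + (b - t) / (N + 1))) atTop (𝓝 (F t')) := by
    have h1 : Tendsto (fun N : ℕ => t' + (b - t) / ((N : ℝ) + 1)) atTop (𝓝 t') := by
      have := (tendsto_one_div_add_atTop_nhds_zero_nat (𝕜 := ℝ)).const_mul (b - t)
      simpa [div_eq_mul_inv] using this.const_add t'
    have h2 : Tendsto (fun N : ℕ => t' + (b - t) / ((N : ℝ) + 1)) atTop (𝓝[≥] t') := by
      refine tendsto_nhdsWithin_iff.2 ⟨h1, Eventually.of_forall fun N => ?_⟩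
      have : 0 ≤ (b - t) / ((N : ℝ) + 1) := div_nonneg (by linarith) (by positivity)
      simpa using this
    exact (F.right_continuous t').tendsto.comp h2
  exact ge_of_tendsto' ((hlim.sub_const _).const_mul _) key

/-! ### The isoperimetric inequality on the line -/

lemma exists_slope_right {F : ℝ → ℝ} (hF : Monotone F) {r b : ℝ}
    (hc : ∀ t t', t ≤ b → b ≤ t' → (F b - F t) * (F (t' + r) - F (b + r)) ≤
      (F (b + r) - F (t + r)) * (F t' - F b)) (hb : ∃ t < b, F t < F b) :
    ∃ β ≥ 0, ∀ t, F (t + r) ≤ F (b + r) + β * (F t - F b) := by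
  let R : Ici b → ℝ := fun t' => (F (t' + r) - F (b + r)) / (F t' - F b)
  have hle : ∀ t ≤ b, F t < F b → ∀ t' : Ici b, R t' ≤ (F (b + r) - F (t + r)) / (F b - F t) := by
    intro t ht htF ⟨t', ht'⟩
    have h1 : 0 ≤ F t' - F b := sub_nonneg.2 (hF ht')
    have h2 : 0 ≤ F (b + r) - F (t + r) := sub_nonneg.2 (hF (by linarith))
    have h3 : 0 < F b - F t := by linarith
    rcases h1.eq_or_lt with h | h
    · simp only [R]; rw [← h, div_zero]; positivity
    · simp only [R]
      rw [div_le_div_iff₀ h h3]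
      have := hc t t' ht ht'
      linarith
  obtain ⟨t₀, ht₀, hF₀⟩ := hb
  have hbdd : BddAbove (range R) := ⟨_, by rintro _ ⟨t', rfl⟩; exact hle t₀ ht₀.le hF₀ t'⟩
  have hR0 : ∀ t', 0 ≤ R t' := fun ⟨t', ht'⟩ =>
    div_nonneg (sub_nonneg.2 (hF (by simp at ht'; linarith))) (sub_nonneg.2 (hF ht'))
  have : Nonempty (Ici b) := ⟨⟨b, by simp⟩⟩
  refine ⟨⨆ t', R t', Real.iSup_nonneg hR0, fun t => ?_⟩
  rcases le_total t b with ht | ht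
  · rcases (hF ht).eq_or_lt with h | h
    · rw [h, sub_self, mul_zero, add_zero]; exact hF (by linarith)
    · have h1 : (⨆ t', R t') ≤ (F (b + r) - F (t + r)) / (F b - F t) := ciSup_le (hle t ht h)
      rw [le_div_iff₀ (by linarith)] at h1
      linarith
  · rcases (hF ht).eq_or_lt with h | h
    · have h1 := hc t₀ t ht₀.le ht
      rw [← h, sub_self, mul_zero] at h1
      have h2 : F (t + r) - F (b + r) ≤ 0 := by
        by_contra h3
        have : 0 < (F b - F t₀) * (F (t + r) - F (b + r)) :=
          mul_pos (by linarith) (by linarith)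
        linarith
      rw [← h, sub_self, mul_zero]; linarith
    · have h1 := le_ciSup hbdd ⟨t, ht⟩
      rw [div_le_iff₀ (by simp only; linarith)] at h1
      simp only at h1
      linarith

/-- The left shift has a supporting slope as well; this is `exists_slope_right` for the
reflected function `t ↦ -F (-t)`. -/
lemma exists_slope_left {F : ℝ → ℝ} (hF : Monotone F) {r a : ℝ}
    (hc : ∀ t t', t ≤ a → a ≤ t' → (F t' - F a) * (F (a - r) - F (t - r)) ≤
      (F (t' - r) - F (a - r)) * (F a - F t)) (ha : ∃ t > a, F a < F t) :
    ∃ β ≥ 0, ∀ t, F (a - r) + β * (F t - F a) ≤ F (t - r) := by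
  obtain ⟨β, hβ, h⟩ := exists_slope_right (F := fun t => -F (-t)) (r := r) (b := -a)
    (fun x y hxy => neg_le_neg (hF (neg_le_neg hxy)))
    (fun t t' ht ht' => by
      have := hc (-t') (-t) (by linarith) (by linarith)
      simp only [neg_neg, neg_add, ← sub_eq_add_neg]
      linarith)
    (by
      obtain ⟨t, ht, h⟩ := ha
      exact ⟨-t, by linarith, by simpa using h⟩)
  refine ⟨β, hβ, fun t => ?_⟩
  have := h (-t)
  simp only [neg_neg, neg_add, ← sub_eq_add_neg] at this
  linarith

lemma le_mul_geom_sum {u : ℕ → ℝ} {α β : ℝ} (hβ : 0 ≤ β) (h0 : u 0 = 0)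
    (h : ∀ j, u (j + 1) ≤ α + β * u j) (k : ℕ) : u k ≤ α * ∑ j ∈ Finset.range k, β ^ j := by
  induction k with
  | zero => simp [h0]
  | succ k ih =>
    rw [geom_sum_succ]
    calc u (k + 1) ≤ α + β * u k := h k
      _ ≤ α + β * (α * ∑ j ∈ Finset.range k, β ^ j) := by gcongr
      _ = _ := by ring

lemma inv_le_of_one_le_mul {a b : ℝ} (hb : 0 ≤ b) (h : 1 ≤ a * b) : b⁻¹ ≤ a := by
  have hb' : 0 < b := lt_of_le_of_ne hb (by rintro rfl; norm_num at h)
  rw [inv_eq_one_div, div_le_iff₀ hb']; exact h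

/-- Isoperimetry for intervals. Of the slopes of the right shift at `b` and the left shift at `a`,
let `β` be the larger one; pushing the interval to the end of the support on the side of the
smaller slope yields `F (t + r) ≤ M - β p + β F t` (or its reflection), where `M` is the measure of
the enlarged interval and `p` that of the interval. Iterating this from one end of the support to
the other, `F` grows from `0` to `1`, which bounds `M` from below. -/
lemma profile_le_cdf_sub {F : ℝ → ℝ} (hF : Monotone F) {r : ℝ} (hr : 0 < r)
    (hc : ∀ t b t', t ≤ b → b ≤ t' → (F b - F t) * (F (t' + r) - F (b + r)) ≤
      (F (b + r) - F (t + r)) * (F t' - F b)) (h0 : ∀ t, 0 ≤ F t) (h1 : ∀ t, F t ≤ 1)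
    {k : ℕ} {e : ℝ} (he0 : F e = 0) (he1 : F (e + k * r) = 1) {a b : ℝ} (hab : a < b)
    (hFab : F a < F b) : profile k (F b - F a) ≤ F (b + r) - F (a - r) := by
  obtain ⟨β, hβ, hR⟩ := exists_slope_right hF (r := r) (b := b) (fun t t' => hc t b t')
    ⟨a, hab, hFab⟩
  obtain ⟨β', hβ', hL⟩ := exists_slope_left hF (r := r) (a := a)
    (fun t t' ht ht' => by
      have := hc (t - r) (a - r) (t' - r) (by linarith) (by linarith)
      simp only [sub_add_cancel] at this
      linarith)
    ⟨b, hab, hFab⟩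
  have hp : 0 ≤ F b - F a := by linarith
  rcases le_total β' β with hle | hle
  · have h2 : F (a - r) ≤ β' * F a := by
      have h := hL e
      have h3 : F (e - r) ≤ F e := hF (by linarith)
      rw [he0] at h h3
      linarith
    have h3 : β' * F a ≤ β * F a := by gcongr; exact h0 a
    have hit := le_mul_geom_sum (u := fun j : ℕ => F (e + j * r)) (β := β)
      (α := F (b + r) - F (a - r) - β * (F b - F a)) hβ (by simpa using he0)
      (fun j => by
        have := hR (e + j * r)
        push_cast
        rw [show e + (j + 1) * r = e + j * r + r by ring]
        linarith) k
    simp only [he1] at hit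
    have h4 := inv_le_of_one_le_mul (Finset.sum_nonneg fun _ _ => pow_nonneg hβ _) hit
    have h5 := profile_le k hp hβ
    linarith
  · have h2 : 1 - F (b + r) ≤ β * (1 - F b) := by
      have h := hR (e + k * r)
      have h3 : F (e + k * r) ≤ F (e + k * r + r) := hF (by linarith)
      rw [he1] at h h3
      linarith
    have h3 : β * (1 - F b) ≤ β' * (1 - F b) := by gcongr; linarith [h1 b]
    have hit := le_mul_geom_sum (u := fun j : ℕ => 1 - F (e + k * r - j * r)) (β := β')
      (α := F (b + r) - F (a - r) - β' * (F b - F a)) hβ' (by simpa using he1.symm ▸ sub_self _)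
      (fun j => by
        have := hL (e + k * r - j * r)
        push_cast
        rw [show e + k * r - (j + 1) * r = e + k * r - j * r - r by ring]
        linarith) k
    simp only [add_sub_cancel_right, he0, sub_zero] at hit
    have h4 := inv_le_of_one_le_mul (Finset.sum_nonneg fun _ _ => pow_nonneg hβ' _) hit
    have h5 := profile_le k hp hβ'
    linarith

lemma profile_le_Icc {ν : Measure ℝ} [IsProbabilityMeasure ν] (hν : IsLogConcaveMeasure ν)
    {k : ℕ} (hk : 2 ≤ k) {r c L : ℝ} (hr : 0 < r) (hL : L < k * r) (hs : ν (Icc c (c + L))ᶜ = 0)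
    (a b : ℝ) : profile k (ν.real (Icc a b)) ≤ ν.real (Icc (a - r) (b + r)) := by
  set F := ProbabilityTheory.cdf ν with hF
  have hIcc : ∀ x y, ν.real (Icc x y) = max (F y - Function.leftLim F x) 0 := fun x y => by
    conv_lhs => rw [← ProbabilityTheory.measure_cdf ν]
    rw [measureReal_def, StieltjesFunction.measure_Icc, ENNReal.toReal_ofReal']
  rcases measureReal_nonneg (μ := ν) (s := Icc a b) |>.eq_or_lt with h | h
  · rw [← h]; exact (profile_zero_le hk).trans measureReal_nonneg
  obtain ⟨e, he1, he2⟩ : ∃ e < c, c + L < e + k * r :=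
    ⟨c - (k * r - L) / 2, by linarith, by linarith⟩
  have he0 : F e = 0 := by
    rw [hF, ProbabilityTheory.cdf_eq_real, measureReal_def]
    have : ν (Iic e) = 0 := measure_mono_null
      (show Iic e ⊆ (Icc c (c + L))ᶜ from fun x hx hx' => by
        linarith [mem_Iic.1 hx, (mem_Icc.1 hx').1]) hs
    simp [this]
  have he1 : F (e + k * r) = 1 := by
    rw [hF, ProbabilityTheory.cdf_eq_real, measureReal_def]
    have : ν (Iic (e + k * r)) = 1 := (prob_compl_eq_zero_iff measurableSet_Iic).1
      (measure_mono_null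
      (show (Iic (e + k * r))ᶜ ⊆ (Icc c (c + L))ᶜ from fun x hx hx' => hx
        (mem_Iic.2 (by linarith [(mem_Icc.1 hx').2]))) hs)
    simp [this]
  have key : ∀ a' < a, profile k (ν.real (Icc a b)) ≤ F (b + r) - F (a' - r) := fun a' ha' => by
    have h1 : F a' ≤ Function.leftLim F a := F.mono.le_leftLim ha'
    have h2 : ν.real (Icc a b) ≤ F b - F a' := by
      rw [hIcc] at h ⊢
      rcases lt_max_iff.1 h with h | h
      · exact max_le (by linarith) (by linarith)
      · exact absurd h (lt_irrefl _)
    have hab : a ≤ b := by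
      by_contra hab
      rw [Icc_eq_empty hab] at h; simp at h
    exact (profile_mono k h.le h2).trans (profile_le_cdf_sub F.mono hr
      (fun t b t' h1 h2 => hν.cdf_cross h1 h2 hr) (ProbabilityTheory.cdf_nonneg ν)
      (ProbabilityTheory.cdf_le_one ν) he0 he1 (by linarith) (by linarith))
  have hlim : Tendsto (fun a' => F (b + r) - F (a' - r)) (𝓝[<] a)
      (𝓝 (F (b + r) - Function.leftLim F (a - r))) := by
    refine ((F.mono.tendsto_leftLim (a - r)).comp ?_).const_sub _
    refine tendsto_nhdsWithin_iff.2 ⟨?_, ?_⟩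
    · exact ((continuous_id.sub continuous_const).tendsto a).mono_left nhdsWithin_le_nhds
    · filter_upwards [self_mem_nhdsWithin] with x hx
      simpa using hx
  rw [hIcc (a - r)]
  refine le_trans (ge_of_tendsto hlim ?_) (le_max_left _ _)
  filter_upwards [self_mem_nhdsWithin] with x hx using key x hx

/-- The isoperimetric inequality on the line. A set whose enlargement is disconnected is split at
a gap; as `profile` is subadditive, this reduces to intervals. -/
lemma profile_le_cthickening_real {ν : Measure ℝ} [IsProbabilityMeasure ν]
    (hν : IsLogConcaveMeasure ν) {k : ℕ} (hk : 2 ≤ k) {r c L : ℝ} (hr : 0 < r) (hL : L < k * r)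
    (hs : ν (Icc c (c + L))ᶜ = 0) {A : Set ℝ} (hA : IsCompact A) :
    profile k (ν.real A) ≤ ν.real (Metric.cthickening r A) := by
  suffices H : ∀ (N : ℕ) (A : Set ℝ), IsCompact A → ∀ u v, A ⊆ Icc u v → v - u ≤ N * r →
      profile k (ν.real A) ≤ ν.real (Metric.cthickening r A) by
    obtain ⟨R, hR⟩ := hA.isBounded.subset_closedBall 0
    rw [Real.closedBall_eq_Icc] at hR
    refine H ⌈(0 + R - (0 - R)) / r⌉₊ A hA _ _ hR ?_
    exact (div_le_iff₀ hr).1 (Nat.le_ceil _)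
  intro N
  induction N with
  | zero =>
    intro A hA u v hAuv huv
    rcases A.eq_empty_or_nonempty with rfl | hne
    · simpa using profile_zero_le hk
    obtain ⟨a, ha⟩ := hne
    have hsub : A ⊆ Icc a a := fun x hx => by
      have h1 := hAuv hx
      have h2 := hAuv ha
      simp only [mem_Icc, Nat.cast_zero, zero_mul] at *
      constructor <;> linarith
    refine (profile_mono k measureReal_nonneg (measureReal_mono hsub)).trans
      ((profile_le_Icc hν hk hr hL hs a a).trans (measureReal_mono ?_))
    rw [← Real.closedBall_eq_Icc]
    exact Metric.closedBall_subset_cthickening ha r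
  | succ N ih =>
    intro A hA u v hAuv huv
    rcases A.eq_empty_or_nonempty with rfl | hne
    · simpa using profile_zero_le hk
    obtain ⟨a, ha, hamin⟩ := hA.exists_isLeast hne
    obtain ⟨b, hb, hbmax⟩ := hA.exists_isGreatest hne
    by_cases hI : Icc (a - r) (b + r) ⊆ Metric.cthickening r A
    · exact (profile_mono k measureReal_nonneg (measureReal_mono
        fun x hx => mem_Icc.2 ⟨hamin hx, hbmax hx⟩)).trans
        ((profile_le_Icc hν hk hr hL hs a b).trans (measureReal_mono hI))
    obtain ⟨z, hz, hzA⟩ := not_subset.1 hI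
    rw [hA.cthickening_eq_biUnion_closedBall hr.le] at hzA
    have hfar : ∀ y ∈ A, r < |z - y| := fun y hy => by
      by_contra hcon
      exact hzA (mem_biUnion hy (by rw [Metric.mem_closedBall, Real.dist_eq]; linarith))
    have hza : a + r < z := by
      have := hfar a ha
      rcases lt_abs.1 this with h | h <;> linarith [hz.1]
    have hzb : z < b - r := by
      have := hfar b hb
      rcases lt_abs.1 this with h | h <;> linarith [hz.2]
    have hA1 : IsCompact (A ∩ Iic z) := hA.inter_right isClosed_Iic
    have hA2 : IsCompact (A ∩ Ici z) := hA.inter_right isClosed_Ici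
    have hs1 : ∀ y ∈ A ∩ Iic z, y < z - r := fun y hy => by
      have := hfar y hy.1
      rw [abs_of_nonneg (sub_nonneg.2 hy.2)] at this; linarith
    have hs2 : ∀ y ∈ A ∩ Ici z, z + r < y := fun y hy => by
      have := hfar y hy.1
      rw [abs_of_nonpos (sub_nonpos.2 hy.2)] at this; linarith
    have hau := hAuv ha
    have hbv := hAuv hb
    simp only [mem_Icc] at hau hbv
    push_cast at huv
    have i1 := ih _ hA1 u (z - r) (fun y hy => mem_Icc.2 ⟨(hAuv hy.1).1, (hs1 y hy).le⟩)
      (by linarith)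
    have i2 := ih _ hA2 (z + r) v (fun y hy => mem_Icc.2 ⟨(hs2 y hy).le, (hAuv hy.1).2⟩)
      (by linarith)
    have hdisj : Disjoint (Metric.cthickening r (A ∩ Iic z))
        (Metric.cthickening r (A ∩ Ici z)) := by
      rw [hA1.cthickening_eq_biUnion_closedBall hr.le, hA2.cthickening_eq_biUnion_closedBall hr.le,
        Set.disjoint_left]
      intro w hw1 hw2
      simp only [mem_iUnion, Metric.mem_closedBall, Real.dist_eq, exists_prop] at hw1 hw2
      obtain ⟨y1, hy1, h1⟩ := hw1
      obtain ⟨y2, hy2, h2⟩ := hw2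
      have := hs1 y1 hy1
      have := hs2 y2 hy2
      have := (abs_le.1 h1).2
      have := (abs_le.1 h2).1
      linarith
    calc profile k (ν.real A) ≤ profile k (ν.real (A ∩ Iic z) + ν.real (A ∩ Ici z)) := by
          refine profile_mono k measureReal_nonneg ((measureReal_mono ?_).trans
            (measureReal_union_le _ _))
          rw [← inter_union_distrib_left, Iic_union_Ici, inter_univ]
      _ ≤ profile k (ν.real (A ∩ Iic z)) + profile k (ν.real (A ∩ Ici z)) :=
          profile_add_le k measureReal_nonneg measureReal_nonneg
      _ ≤ _ := add_le_add i1 i2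
      _ = ν.real (Metric.cthickening r (A ∩ Iic z) ∪ Metric.cthickening r (A ∩ Ici z)) :=
          (measureReal_union hdisj Metric.isClosed_cthickening.measurableSet).symm
      _ ≤ _ := measureReal_mono (union_subset
          (Metric.cthickening_subset_of_subset r inter_subset_left)
          (Metric.cthickening_subset_of_subset r inter_subset_left))

/-! ### Operations on log-concave measures -/

lemma IsLogConcaveMeasure.restrict {E : Type*} [NormedAddCommGroup E] [NormedSpace ℝ E]
    [MeasurableSpace E] {μ : Measure E} (hμ : IsLogConcaveMeasure μ) {C : Set E}
    (hC : Convex ℝ C) (hCm : MeasurableSet C) : IsLogConcaveMeasure (μ.restrict C) := by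
  intro A B hA hB t ht
  rw [Measure.restrict_apply hA, Measure.restrict_apply hB, Measure.restrict_apply' hCm]
  refine (hμ _ _ (hA.inter hCm) (hB.inter hCm) t ht).trans (measure_mono ?_)
  rintro _ ⟨_, ⟨a, ha, rfl⟩, _, ⟨b, hb, rfl⟩, rfl⟩
  exact ⟨⟨_, ⟨a, ha.1, rfl⟩, _, ⟨b, hb.1, rfl⟩, rfl⟩,
    hC ha.2 hb.2 ht.1.le (by linarith [ht.2]) (by ring)⟩

lemma IsLogConcaveMeasure.map {E F : Type*} [NormedAddCommGroup E] [NormedSpace ℝ E]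
    [MeasurableSpace E] [NormedAddCommGroup F] [NormedSpace ℝ F] [MeasurableSpace F]
    {μ : Measure E} (hμ : IsLogConcaveMeasure μ) (L : E →ₗ[ℝ] F) (hL : Measurable L) :
    IsLogConcaveMeasure (μ.map L) := by
  intro A B hA hB t ht
  rw [Measure.map_apply hL hA, Measure.map_apply hL hB]
  refine ((hμ _ _ (hL hA) (hL hB) t ht).trans (measure_mono ?_)).trans
    (Measure.le_map_apply hL.aemeasurable _)
  rintro _ ⟨_, ⟨a, ha, rfl⟩, _, ⟨b, hb, rfl⟩, rfl⟩
  exact ⟨_, ⟨_, ha, rfl⟩, _, ⟨_, hb, rfl⟩, by simp⟩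

lemma IsLogConcaveMeasure.const_smul {E : Type*} [NormedAddCommGroup E] [NormedSpace ℝ E]
    [MeasurableSpace E] {μ : Measure E} (hμ : IsLogConcaveMeasure μ) {c : ℝ≥0∞} (h0 : c ≠ 0)
    (h1 : c ≠ ∞) : IsLogConcaveMeasure (c • μ) := by
  intro A B hA hB t ht
  simp only [Measure.smul_apply, smul_eq_mul]
  rw [ENNReal.mul_rpow_of_nonneg _ _ ht.1.le,
    ENNReal.mul_rpow_of_nonneg _ _ (sub_nonneg.2 ht.2.le)]
  have hc : c ^ t * c ^ (1 - t) = c := by rw [← ENNReal.rpow_add _ _ h0 h1]; simp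
  calc c ^ t * μ A ^ t * (c ^ (1 - t) * μ B ^ (1 - t))
      = (c ^ t * c ^ (1 - t)) * (μ A ^ t * μ B ^ (1 - t)) := by ring
    _ ≤ _ := by rw [hc]; gcongr; exact hμ A B hA hB t ht

/-! ### Log-concave measures and hyperplanes -/

/-- If `c` is an atom, then the mass of `(c, c + b]` is carried arbitrarily close to `c` by convex
combinations with `{c}`. -/
lemma IsLogConcaveMeasure.measure_Ioi_eq_zero {ν : Measure ℝ} [IsFiniteMeasure ν]
    (hν : IsLogConcaveMeasure ν) {c : ℝ} (hc : ν {c} ≠ 0) : ν (Ioi c) = 0 := by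
  have hIoc : ∀ b : ℝ, 0 < b → ν (Ioc c (c + b)) = 0 := by
    intro b hb
    by_contra hb0
    set m := min (ν.real {c}) (ν.real (Ioc c (c + b))) with hm
    have hm0 : 0 < m := lt_min (ENNReal.toReal_pos hc (measure_ne_top _ _))
      (ENNReal.toReal_pos hb0 (measure_ne_top _ _))
    have hle : ∀ n : ℕ, m ≤ ν.real (Ioc c (c + b / (n + 2))) := fun n => by
      have hn : (0 : ℝ) < n + 2 := by positivity
      set t : ℝ := 1 - 1 / (n + 2) with ht
      have htI : t ∈ Ioo (0 : ℝ) 1 := by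
        have h1 : 0 < 1 / ((n : ℝ) + 2) := by positivity
        have h2 : 1 / ((n : ℝ) + 2) < 1 := by rw [div_lt_one hn]; linarith [n.cast_nonneg (α := ℝ)]
        exact ⟨by linarith, by linarith⟩
      calc m = m ^ t * m ^ (1 - t) := by rw [← Real.rpow_add hm0]; simp
        _ ≤ ν.real {c} ^ t * ν.real (Ioc c (c + b)) ^ (1 - t) := by
            have := htI.1
            have : 0 ≤ 1 - t := by linarith [htI.2]
            gcongr
            · exact min_le_left _ _
            · exact min_le_right _ _
        _ ≤ _ := by
            refine hν.real_le (measurableSet_singleton c) measurableSet_Ioc htI ?_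
            rintro _ ⟨_, ⟨x, hx, rfl⟩, _, ⟨y, hy, rfl⟩, rfl⟩
            have h1t : 1 - t = 1 / (n + 2) := by rw [ht]; ring
            rw [mem_singleton_iff] at hx
            subst hx
            have h2 : t * x + (1 - t) * y = x + (y - x) / (n + 2) := by rw [ht]; ring
            simp only [smul_eq_mul]
            rw [h2]
            refine mem_Ioc.2 ⟨?_, ?_⟩
            · have : 0 < (y - x) / (n + 2) := div_pos (by linarith [hy.1]) hn
              linarith
            · gcongr; linarith [hy.2]
    have hlim : Tendsto (fun n : ℕ => ν (Ioc c (c + b / (n + 2)))) atTop (𝓝 (ν ∅)) := by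
      refine tendsto_measure_of_tendsto_indicator_of_isFiniteMeasure _ _
        (fun _ => measurableSet_Ioc) fun x => ?_
      rcases le_or_gt x c with hx | hx
      · exact Eventually.of_forall fun n => by simp [hx.not_gt]
      · have h1 : Tendsto (fun n : ℕ => c + b / ((n : ℝ) + 2)) atTop (𝓝 (c + 0)) :=
          ((tendsto_const_nhds (x := b)).div_atTop
            (tendsto_atTop_add_const_right _ _ tendsto_natCast_atTop_atTop)).const_add c
        rw [add_zero] at h1
        filter_upwards [h1.eventually (gt_mem_nhds hx)] with n hn
        simp [hn]
    rw [measure_empty] at hlim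
    have h2 := (ENNReal.tendsto_toReal ENNReal.zero_ne_top).comp hlim
    have h3 := ge_of_tendsto' h2 hle
    simp at h3
    linarith
  have : Ioi c = ⋃ n : ℕ, Ioc c (c + (n + 1)) := by
    ext x
    simp only [mem_Ioi, mem_iUnion, mem_Ioc]
    refine ⟨fun h => ?_, fun ⟨_, h⟩ => h.1⟩
    obtain ⟨n, hn⟩ := exists_nat_ge (x - c)
    exact ⟨n, h, by linarith⟩
  rw [this, measure_iUnion_null_iff]
  exact fun n => hIoc _ (by positivity)

lemma IsLogConcaveMeasure.measure_compl_singleton {ν : Measure ℝ} [IsFiniteMeasure ν]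
    (hν : IsLogConcaveMeasure ν) {c : ℝ} (hc : ν {c} ≠ 0) : ν {c}ᶜ = 0 := by
  have h1 := hν.measure_Ioi_eq_zero hc
  have hneg : Measurable (-LinearMap.id : ℝ →ₗ[ℝ] ℝ) := measurable_neg
  have h2 : (ν.map (-LinearMap.id : ℝ →ₗ[ℝ] ℝ)) (Ioi (-c)) = 0 := by
    refine (hν.map _ hneg).measure_Ioi_eq_zero ?_
    rw [Measure.map_apply hneg (measurableSet_singleton _)]
    convert hc using 2
    ext; simp
  rw [Measure.map_apply hneg measurableSet_Ioi] at h2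
  rw [← Iio_union_Ioi, measure_union_null_iff]
  refine ⟨?_, h1⟩
  convert h2 using 2
  ext; simp

lemma IsLogConcaveMeasure.hyperplane {E : Type*} [NormedAddCommGroup E] [NormedSpace ℝ E]
    [MeasurableSpace E] [BorelSpace E] {μ : Measure E} [IsFiniteMeasure μ]
    (hμ : IsLogConcaveMeasure μ) (L : E →L[ℝ] ℝ) (c : ℝ) :
    μ {q | L q = c} = 0 ∨ μ {q | L q ≠ c} = 0 := by
  have hL : Measurable (L : E →ₗ[ℝ] ℝ) := L.continuous.measurable
  by_cases h : (μ.map (L : E →ₗ[ℝ] ℝ)) {c} = 0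
  · left
    rwa [Measure.map_apply hL (measurableSet_singleton _)] at h
  · right
    have := (hμ.map _ hL).measure_compl_singleton h
    rwa [Measure.map_apply hL (measurableSet_singleton _).compl] at this

/-! ### Localization -/

/-- A triangle with vertices `z, y, w` whose image under `(f, g)` contains the image of `p` in its
interior (expressed through barycentric coordinates) does not lie on one side of a line through
the latter. -/
lemma not_halfplane_of_barycentric {E : Type*} [NormedAddCommGroup E]
    [NormedSpace ℝ E] {f g : E →L[ℝ] ℝ} {p z y w : E} {α β : ℝ}
    (hαβ : α ≠ 0 ∨ β ≠ 0) (hz : 0 ≤ α * f (z - p) + β * g (z - p))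
    (hy : 0 ≤ α * f (y - p) + β * g (y - p)) (hw : 0 ≤ α * f (w - p) + β * g (w - p))
    (h1 : 0 < f (y - p) * g (w - p) - f (w - p) * g (y - p))
    (h2 : 0 < f (w - p) * g (z - p) - f (z - p) * g (w - p))
    (h3 : 0 < f (z - p) * g (y - p) - f (y - p) * g (z - p)) : False := by
  generalize f (z - p) = a1 at *
  generalize g (z - p) = b1 at *
  generalize f (y - p) = a2 at *
  generalize g (y - p) = b2 at *
  generalize f (w - p) = a3 at *
  generalize g (w - p) = b3 at *
  have key : (a2 * b3 - a3 * b2) * (α * a1 + β * b1) + (a3 * b1 - a1 * b3) * (α * a2 + β * b2)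
      + (a1 * b2 - a2 * b1) * (α * a3 + β * b3) = 0 := by ring
  have m1 := mul_nonneg h1.le hz
  have m2 := mul_nonneg h2.le hy
  have m3 := mul_nonneg h3.le hw
  have e1 : α * a1 + β * b1 = 0 :=
    (mul_eq_zero.1 (by linarith : (a2 * b3 - a3 * b2) * (α * a1 + β * b1) = 0)).resolve_left h1.ne'
  have e2 : α * a2 + β * b2 = 0 :=
    (mul_eq_zero.1 (by linarith : (a3 * b1 - a1 * b3) * (α * a2 + β * b2) = 0)).resolve_left h2.ne'
  have hα : (a1 * b2 - a2 * b1) * α = 0 := by linear_combination b2 * e1 - b1 * e2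
  have hβ : (a1 * b2 - a2 * b1) * β = 0 := by linear_combination a1 * e2 - a2 * e1
  rcases hαβ with h | h
  · exact h ((mul_eq_zero.1 hα).resolve_left h3.ne')
  · exact h ((mul_eq_zero.1 hβ).resolve_left h3.ne')

section Localization

variable {E : Type*} [NormedAddCommGroup E] [NormedSpace ℝ E] [MeasurableSpace E] [BorelSpace E]

/-- A compact convex set `C` in which `S` has relative measure exactly `x`, while `T` has relative
measure less than `c`. In particular `μ C > 0`. -/
def IsBadBody (μ : Measure E) (S T : Set E) (x c : ℝ) (C : Set E) : Prop :=
  IsCompact C ∧ Convex ℝ C ∧ μ.real (S ∩ C) = x * μ.real C ∧ μ.real (T ∩ C) < c * μ.real C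

lemma measureReal_inter_halfspaces {μ : Measure E} [IsFiniteMeasure μ] (U : E →L[ℝ] ℝ) (p : E)
    {C : Set E} (h : μ (C ∩ {q | U q = U p}) = 0) (X : Set E) :
    μ.real (X ∩ C) = μ.real (X ∩ (C ∩ {q | 0 ≤ U (q - p)}))
      + μ.real (X ∩ (C ∩ {q | U (q - p) ≤ 0})) := by
  have hm : MeasurableSet {q | 0 ≤ U (q - p)} :=
    (isClosed_le continuous_const (by fun_prop)).measurableSet
  rw [← measureReal_inter_add_sdiff (s := X ∩ C) hm, ← inter_assoc, ← inter_assoc]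
  congr 1
  refine measureReal_congr (EventuallyLE.antisymm ?_ ?_)
  · refine LE.le.eventuallyLE fun q hq => ⟨hq.1, ?_⟩
    have := hq.2
    simp only [mem_ofPred_eq, not_le] at this ⊢
    exact this.le
  · refine ae_le_set.2 (measure_mono_null ?_ h)
    rintro q ⟨⟨⟨hX, hC⟩, h1⟩, h2⟩
    refine ⟨hC, ?_⟩
    have h3 : 0 ≤ U (q - p) := by
      by_contra h4
      exact h2 ⟨⟨hX, hC⟩, h4⟩
    have h4 := le_antisymm h1 h3
    rw [map_sub] at h4
    simpa [sub_eq_zero] using h4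

lemma continuous_measureReal_halfspace {ρ : Measure E} [IsFiniteMeasure ρ] (f g : E →L[ℝ] ℝ) (p : E)
    (h : ∀ θ : ℝ, ρ {q | (Real.cos θ • f + Real.sin θ • g) q =
      (Real.cos θ • f + Real.sin θ • g) p} = 0) :
    Continuous fun θ : ℝ => ρ.real {q | 0 ≤ (Real.cos θ • f + Real.sin θ • g) (q - p)} := by
  have hm : ∀ θ : ℝ, MeasurableSet {q | 0 ≤ (Real.cos θ • f + Real.sin θ • g) (q - p)} := fun θ =>
    (isClosed_le continuous_const (by fun_prop)).measurableSet
  refine continuous_iff_continuousAt.2 fun θ => ?_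
  refine (ENNReal.tendsto_toReal (measure_ne_top _ _)).comp ?_
  refine tendsto_measure_of_ae_tendsto_indicator_of_isFiniteMeasure _ (hm θ) hm ?_
  have h0 : ∀ᵐ q ∂ρ, (Real.cos θ • f + Real.sin θ • g) q ≠ (Real.cos θ • f + Real.sin θ • g) p := by
    simpa [ae_iff] using h θ
  filter_upwards [h0] with q hq
  have hne : (Real.cos θ • f + Real.sin θ • g) (q - p) ≠ 0 := by
    rwa [map_sub, sub_ne_zero]
  have hc : Continuous fun θ : ℝ => (Real.cos θ • f + Real.sin θ • g) (q - p) := by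
    simp only [_root_.add_apply, _root_.smul_apply]
    fun_prop
  rcases hne.lt_or_gt with hlt | hgt
  · filter_upwards [hc.continuousAt.eventually (gt_mem_nhds hlt)] with η hη
    exact ⟨fun h => absurd h hη.not_ge, fun h => absurd h hlt.not_ge⟩
  · filter_upwards [hc.continuousAt.eventually (lt_mem_nhds hgt)] with η hη
    exact ⟨fun _ => hgt.le, fun _ => hη.le⟩

/-- A bad body contains a bad body on one side of a hyperplane through the flat
`{q | f q = f p, g q = g p}` of codimension two: turning the hyperplane by `π` exchanges the sides,
so some position bisects the defect of `S`, and one of the two sides is bad. If some position has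
positive measure, then all the mass lies on that hyperplane. -/
lemma IsBadBody.exists_halfspace {μ : Measure E} [IsFiniteMeasure μ] (hμ : IsLogConcaveMeasure μ)
    {S T : Set E} (hS : MeasurableSet S) {x c : ℝ} {C : Set E}
    (hC : IsBadBody μ S T x c C) (f g : E →L[ℝ] ℝ) (p : E) :
    ∃ C' ⊆ C, IsBadBody μ S T x c C' ∧ ∃ α β : ℝ, (α ≠ 0 ∨ β ≠ 0) ∧
      ∀ q ∈ C', 0 ≤ α * f (q - p) + β * g (q - p) := by
  obtain ⟨hCc, hCv, hSC, hTC⟩ := hC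
  set U : ℝ → E →L[ℝ] ℝ := fun θ => Real.cos θ • f + Real.sin θ • g with hU
  have hCm := hCc.measurableSet
  have hne : ∀ θ : ℝ, Real.cos θ ≠ 0 ∨ Real.sin θ ≠ 0 := fun θ => by
    by_contra! h
    have := Real.sin_sq_add_cos_sq θ
    rw [h.1, h.2] at this; norm_num at this
  have hlc := hμ.restrict hCv hCm
  by_cases hA : ∃ θ, μ.restrict C {q | U θ q ≠ U θ p} = 0
  · obtain ⟨θ, hθ⟩ := hA
    rw [Measure.restrict_apply' hCm] at hθ
    have hX : ∀ X : Set E, μ.real (X ∩ (C ∩ {q | U θ q = U θ p})) = μ.real (X ∩ C) := fun X => by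
      refine measureReal_congr (EventuallyLE.antisymm ?_ ?_)
      · exact LE.le.eventuallyLE (inter_subset_inter_right _ inter_subset_left)
      · refine ae_le_set.2 (measure_mono_null ?_ hθ)
        rintro q ⟨⟨h1, h2⟩, h3⟩
        exact ⟨fun h => h3 ⟨h1, h2, h⟩, h2⟩
    have hu := hX univ
    rw [univ_inter, univ_inter] at hu
    refine ⟨C ∩ {q | U θ q = U θ p}, inter_subset_left, ⟨?_, ?_, ?_, ?_⟩, Real.cos θ, Real.sin θ,
      hne θ, ?_⟩
    · exact hCc.inter_right (isClosed_eq (U θ).continuous continuous_const)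
    · exact hCv.inter (convex_hyperplane (U θ).isLinear _)
    · rw [hX, hu, hSC]
    · rw [hX, hu]; exact hTC
    · rintro q ⟨-, hq⟩
      have : U θ (q - p) = 0 := by rw [map_sub, sub_eq_zero]; exact hq
      exact this.ge
  · push Not at hA
    have hnull : ∀ θ, μ.restrict C {q | U θ q = U θ p} = 0 := fun θ =>
      (hlc.hyperplane (U θ) (U θ p)).resolve_right (hA θ)
    have hnull' : ∀ θ, μ (C ∩ {q | U θ q = U θ p}) = 0 := fun θ => by
      rw [inter_comm, ← Measure.restrict_apply' hCm]; exact hnull θ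
    have hm : ∀ θ : ℝ, MeasurableSet {q | 0 ≤ U θ (q - p)} := fun θ =>
      (isClosed_le continuous_const (by fun_prop)).measurableSet
    have hcont : ∀ X : Set E, MeasurableSet X →
        Continuous fun θ => μ.real (X ∩ (C ∩ {q | 0 ≤ U θ (q - p)})) := fun X hX => by
      have h := continuous_measureReal_halfspace (ρ := μ.restrict (X ∩ C)) f g p (fun θ =>
        le_antisymm ((Measure.restrict_mono inter_subset_right le_rfl _).trans (hnull θ).le)
          (zero_le))
      convert h using 2 with θ
      rw [measureReal_def, measureReal_def, Measure.restrict_apply (hm θ)]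
      congr 2
      rw [inter_comm _ (X ∩ C), inter_assoc]
    have hsplit := fun θ => measureReal_inter_halfspaces (U θ) p (hnull' θ)
    set F : ℝ → ℝ := fun θ => μ.real (S ∩ (C ∩ {q | 0 ≤ U θ (q - p)}))
      - x * μ.real (univ ∩ (C ∩ {q | 0 ≤ U θ (q - p)})) with hF
    have hFc : Continuous F := (hcont S hS).sub ((hcont univ MeasurableSet.univ).const_mul x)
    have hπ : {q : E | 0 ≤ U Real.pi (q - p)} = {q | U 0 (q - p) ≤ 0} := by
      ext q; simp [hU]
    have hsum : F 0 + F Real.pi = 0 := by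
      have h1 := hsplit 0 S
      have h2 := hsplit 0 univ
      simp only [hF, hπ]
      rw [univ_inter] at h2
      linear_combination -h1 + x * h2 + hSC
    obtain ⟨θ, -, hθ⟩ : (0 : ℝ) ∈ F '' uIcc 0 Real.pi := by
      refine intermediate_value_uIcc hFc.continuousOn ?_
      rcases le_total (F 0) 0 with h | h
      · rw [uIcc_of_le (by linarith)]; exact mem_Icc.2 ⟨h, by linarith⟩
      · rw [uIcc_of_ge (by linarith)]; exact mem_Icc.2 ⟨by linarith, h⟩
    have hS1 := hsplit θ S
    have hT1 := hsplit θ T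
    have hC1 := hsplit θ univ
    simp only [hF] at hθ
    simp only [univ_inter] at hC1 hθ
    by_cases hside : μ.real (T ∩ (C ∩ {q | 0 ≤ U θ (q - p)}))
        < c * μ.real (C ∩ {q | 0 ≤ U θ (q - p)})
    · refine ⟨_, inter_subset_left, ⟨hCc.inter_right ?_, hCv.inter ?_, by linarith, hside⟩,
        Real.cos θ, Real.sin θ, hne θ, fun q hq => hq.2⟩
      · exact isClosed_le continuous_const (by fun_prop)
      · simp only [map_sub, sub_nonneg]
        exact convex_halfSpace_ge (U θ).isLinear _
    · refine ⟨C ∩ {q | U θ (q - p) ≤ 0}, inter_subset_left,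
        ⟨hCc.inter_right ?_, hCv.inter ?_, ?_, ?_⟩,
        -Real.cos θ, -Real.sin θ, by simpa using hne θ, fun q hq => ?_⟩
      · exact isClosed_le (by fun_prop) continuous_const
      · simp only [map_sub, sub_nonpos]
        exact convex_halfSpace_le (U θ).isLinear _
      · linear_combination hSC - hS1 + x * hC1 - hθ
      · have h2 : c * μ.real C = c * μ.real (C ∩ {q | 0 ≤ U θ (q - p)})
            + c * μ.real (C ∩ {q | U θ (q - p) ≤ 0}) := by rw [hC1, mul_add]
        push Not at hside
        linarith
      · have : Real.cos θ * f (q - p) + Real.sin θ * g (q - p) ≤ 0 := hq.2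
        linarith

/-- A bad body contains bad bodies that are arbitrarily close to a segment: their points are
separated, up to `ε`, as far as their images under a functional `φ` of norm at most one. They are
found by cutting successively through a dense sequence of flats of codimension two. -/
lemma IsBadBody.exists_thin [FiniteDimensional ℝ E] {μ : Measure E} [IsFiniteMeasure μ]
    (hμ : IsLogConcaveMeasure μ) {S T : Set E} (hS : MeasurableSet S)
    {x c : ℝ} {K : Set E} (hK : IsBadBody μ S T x c K) {ε : ℝ} (hε : 0 < ε) :
    ∃ C ⊆ K, IsBadBody μ S T x c C ∧ ∃ φ : E →L[ℝ] ℝ, ‖φ‖ ≤ 1 ∧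
      ∀ y ∈ C, ∀ z ∈ C, ‖y - z‖ ≤ |φ y - φ z| + ε := by
  have := FiniteDimensional.proper ℝ E
  have := FiniteDimensional.proper ℝ (E →L[ℝ] ℝ)
  let d : ℕ → (E →L[ℝ] ℝ) × (E →L[ℝ] ℝ) × E := TopologicalSpace.denseSeq _
  have hd : DenseRange d := TopologicalSpace.denseRange_denseSeq _
  choose next hsub hbad hcut using fun (D : (E →L[ℝ] ℝ) × (E →L[ℝ] ℝ) × E)
    (C : {C : Set E // IsBadBody μ S T x c C}) =>
    C.2.exists_halfspace hμ hS D.1 D.2.1 D.2.2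
  let V : ℕ → {C : Set E // IsBadBody μ S T x c C} := fun n =>
    Nat.rec ⟨K, hK⟩ (fun i C => ⟨next (d i) C, hbad (d i) C⟩) n
  have hVs : ∀ n, (V (n + 1)).1 ⊆ (V n).1 := fun n => hsub (d n) (V n)
  have hVanti : Antitone fun n => (V n).1 := antitone_nat_of_succ_le hVs
  have hVc : ∀ n, IsCompact (V n).1 := fun n => (V n).2.1
  have hVdir : Directed (· ⊇ ·) fun n => (V n).1 := hVanti.directed_ge
  have hVne : ∀ n, (V n).1.Nonempty := fun n => by
    by_contra h
    rw [not_nonempty_iff_eq_empty] at h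
    have := (V n).2.2.2.2
    rw [h] at this; simp at this
  obtain ⟨z, hz⟩ : (⋂ n, (V n).1).Nonempty :=
    IsCompact.nonempty_iInter_of_directed_nonempty_isCompact_isClosed _ hVdir hVne hVc
      fun n => (hVc n).isClosed
  -- The intersection contains no nondegenerate triangle.
  have htri : ∀ y ∈ ⋂ n, (V n).1, ∀ w ∈ ⋂ n, (V n).1, y - z ≠ 0 →
      w - z ∈ Submodule.span ℝ {y - z} := by
    intro y hy w hw hyz
    by_contra hspan
    obtain ⟨g₀, hg₀1, hg₀2⟩ := Submodule.exists_dual_map_eq_bot_of_notMem hspan inferInstance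
    obtain ⟨f₀, -, hf₀⟩ := exists_dual_vector'' ℝ (y - z)
    have hg₀3 : g₀ (y - z) = 0 := by
      have : g₀ (y - z) ∈ (Submodule.span ℝ {y - z}).map g₀ :=
        Submodule.mem_map_of_mem (Submodule.mem_span_singleton_self _)
      rw [hg₀2] at this; simpa using this
    -- After scaling, `g` is positive at `w - z`, so that the triangle is positively oriented.
    set g₁ : E →L[ℝ] ℝ := g₀ (w - z) • LinearMap.toContinuousLinearMap g₀ with hg₁
    have hg1 : 0 < g₁ (w - z) := by
      simp only [hg₁, _root_.smul_apply, LinearMap.coe_toContinuousLinearMap',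
        smul_eq_mul]
      exact mul_self_pos.2 hg₀1
    have hg2 : g₁ (y - z) = 0 := by simp [hg₁, hg₀3]
    have hf1 : 0 < f₀ (y - z) := by rw [hf₀]; simpa using hyz
    let O : Set ((E →L[ℝ] ℝ) × (E →L[ℝ] ℝ) × E) :=
      {D | 0 < D.1 (y - D.2.2) * D.2.1 (w - D.2.2) - D.1 (w - D.2.2) * D.2.1 (y - D.2.2)} ∩
      ({D | 0 < D.1 (w - D.2.2) * D.2.1 (z - D.2.2) - D.1 (z - D.2.2) * D.2.1 (w - D.2.2)} ∩
      {D | 0 < D.1 (z - D.2.2) * D.2.1 (y - D.2.2) - D.1 (y - D.2.2) * D.2.1 (z - D.2.2)})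
    have hO : IsOpen O := by
      refine (isOpen_lt continuous_const ?_).inter ((isOpen_lt continuous_const ?_).inter
        (isOpen_lt continuous_const ?_)) <;> fun_prop
    have hOne : O.Nonempty := by
      refine ⟨(f₀, g₁, (3⁻¹ : ℝ) • (z + y + w)), ?_⟩
      have ey : y = z + (y - z) := by abel
      have ew : w = z + (w - z) := by abel
      have pos : 0 < f₀ (y - z) * g₁ (w - z) := mul_pos hf1 hg1
      simp only [map_sub] at pos hg2
      simp only [O, mem_inter_iff, mem_ofPred_eq, map_sub, map_smul, map_add, smul_eq_mul]
      have hgy : g₁ y = g₁ z := by linarith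
      rw [hgy]
      refine ⟨?_, ?_, ?_⟩ <;> nlinarith
    obtain ⟨n, hn⟩ := hd.exists_mem_open hO hOne
    obtain ⟨α, β, hαβ, hpos⟩ := hcut (d n) (V n)
    have hmem : ∀ q ∈ ⋂ n, (V n).1, q ∈ next (d n) (V n) := fun q hq =>
      mem_iInter.1 hq (n + 1)
    exact not_halfplane_of_barycentric hαβ (hpos z (hmem z hz)) (hpos y (hmem y hy))
      (hpos w (hmem w hw)) hn.1 hn.2.1 hn.2.2
  obtain ⟨φ, hφ1, hφ⟩ : ∃ φ : E →L[ℝ] ℝ, ‖φ‖ ≤ 1 ∧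
      ∀ y ∈ ⋂ n, (V n).1, ∀ w ∈ ⋂ n, (V n).1, ‖y - w‖ = |φ y - φ w| := by
    obtain ⟨v, hv⟩ : ∃ v : E, ∀ w ∈ ⋂ n, (V n).1, w - z ∈ Submodule.span ℝ {v} := by
      by_cases h : ∃ y ∈ ⋂ n, (V n).1, y - z ≠ 0
      · obtain ⟨y, hy, hyz⟩ := h
        exact ⟨y - z, fun w hw => htri y hy w hw hyz⟩
      · push Not at h
        exact ⟨0, fun w hw => by rw [h w hw]; exact Submodule.zero_mem _⟩
    obtain ⟨φ, hφ1, hφ⟩ := exists_dual_vector'' ℝ v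
    refine ⟨φ, hφ1, fun y hy w hw => ?_⟩
    have h1 : y - w ∈ Submodule.span ℝ {v} := by
      have := Submodule.sub_mem _ (hv y hy) (hv w hw)
      rwa [sub_sub_sub_cancel_right] at this
    obtain ⟨a, ha⟩ := Submodule.mem_span_singleton.1 h1
    rw [← map_sub, ← ha, map_smul, hφ, norm_smul, smul_eq_mul, abs_mul]
    simp
  obtain ⟨n, hn⟩ := exists_subset_nhds_of_isCompact (U := Metric.thickening (ε / 4)
    (⋂ n, (V n).1)) hVdir hVc
    fun q hq => Metric.isOpen_thickening.mem_nhds (Metric.self_subset_thickening (by linarith) _ hq)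
  refine ⟨(V n).1, hVanti (Nat.zero_le n), (V n).2, φ, hφ1, fun y hy w hw => ?_⟩
  obtain ⟨y', hy', hyd⟩ := Metric.mem_thickening_iff.1 (hn hy)
  obtain ⟨w', hw', hwd⟩ := Metric.mem_thickening_iff.1 (hn hw)
  have hlip : ∀ a b : E, |φ a - φ b| ≤ dist a b := fun a b => by
    rw [← map_sub, dist_eq_norm, ← Real.norm_eq_abs]
    exact (φ.le_of_opNorm_le hφ1 _).trans (by rw [one_mul])
  have h1 := hφ y' hy' w' hw'
  have h2 := abs_le.1 (hlip y y')
  have h3 := abs_le.1 (hlip w w')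
  have h4 : |φ y' - φ w'| ≤ |φ y - φ w| + ε / 2 := by
    have := le_abs_self (φ y - φ w)
    have := neg_abs_le (φ y - φ w)
    refine abs_le.2 ⟨by linarith, by linarith⟩
  have h5 : dist y w ≤ dist y y' + dist y' w' + dist w' w := dist_triangle4 _ _ _ _
  rw [dist_comm w' w, dist_eq_norm y' w', dist_eq_norm y w] at h5
  linarith

end Localization

/-! ### The isoperimetric inequality -/

section Isoperimetry

variable {E : Type*} [NormedAddCommGroup E] [NormedSpace ℝ E] [FiniteDimensional ℝ E]
  [MeasurableSpace E] [BorelSpace E]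

/-- The inequality at distance `h` for compact sets: in a thin body violating it, the law of the
functional along which the body extends would violate the inequality on the line. -/
lemma profile_le_cthickening {μ : Measure E} [IsProbabilityMeasure μ] (hμ : IsLogConcaveMeasure μ)
    {K : Set E} (hKc : IsCompact K) (hKv : Convex ℝ K) (hμK : μ Kᶜ = 0) {S : Set E}
    (hS : IsCompact S) (hSK : S ⊆ K) {k : ℕ} (hk : 2 ≤ k) {h : ℝ}
    (hD : Metric.diam K < k * h) : profile k (μ.real S) ≤ μ.real (Metric.cthickening h S) := by
  have hk0 : (0 : ℝ) < k := by positivity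
  obtain ⟨r, hr0, hDr, hrh⟩ : ∃ r, 0 < r ∧ Metric.diam K < k * r ∧ r < h := by
    have h1 : Metric.diam K / k < h := by rw [div_lt_iff₀ hk0]; linarith
    have h2 : 0 ≤ Metric.diam K / k := div_nonneg Metric.diam_nonneg hk0.le
    refine ⟨(Metric.diam K / k + h) / 2, by linarith, ?_, by linarith⟩
    rw [mul_comm, ← div_lt_iff₀ hk0]; linarith
  by_contra hcon
  push Not at hcon
  have hK1 : μ.real K = 1 := by
    rw [measureReal_def, (prob_compl_eq_zero_iff hKc.measurableSet).1 hμK]; simp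
  have hbad : IsBadBody μ S (Metric.cthickening h S) (μ.real S) (profile k (μ.real S)) K := by
    refine ⟨hKc, hKv, ?_, ?_⟩
    · rw [inter_eq_left.2 hSK, hK1, mul_one]
    · rw [hK1, mul_one]; exact (measureReal_mono inter_subset_left).trans_lt hcon
  obtain ⟨C, hCK, ⟨hCc, hCv, hSC, hTC⟩, φ, hφ, hthin⟩ :=
    hbad.exists_thin hμ hS.measurableSet (sub_pos.2 hrh)
  have hCm := hCc.measurableSet
  have hC0 : μ C ≠ 0 := by
    intro h0
    have h1 : μ.real C = 0 := by rw [measureReal_def, h0]; simp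
    rw [h1, mul_zero] at hTC
    exact absurd hTC measureReal_nonneg.not_gt
  have hCpos : 0 < μ.real C := ENNReal.toReal_pos hC0 (measure_ne_top _ _)
  have hφm : Measurable (φ : E →ₗ[ℝ] ℝ) := φ.continuous.measurable
  have hcond := ProbabilityTheory.cond_isProbabilityMeasure hC0
  -- The distribution of `φ` under the normalized restriction of `μ` to `C`.
  set ν := (ProbabilityTheory.cond μ C).map (φ : E →ₗ[ℝ] ℝ) with hν
  have hνp : IsProbabilityMeasure ν := Measure.isProbabilityMeasure_map hφm.aemeasurable
  have hνl : IsLogConcaveMeasure ν :=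
    ((hμ.restrict hCv hCm).const_smul (ENNReal.inv_ne_zero.2 (measure_ne_top _ _))
      (ENNReal.inv_ne_top.2 hC0)).map _ hφm
  have hνr : ∀ B : Set ℝ, MeasurableSet B → ν.real B * μ.real C = μ.real (C ∩ φ ⁻¹' B) := by
    intro B hB
    rw [hν, measureReal_def, Measure.map_apply hφm hB, ProbabilityTheory.cond_apply hCm,
      ENNReal.toReal_mul, ENNReal.toReal_inv]
    change (μ.real C)⁻¹ * μ.real (C ∩ φ ⁻¹' B) * μ.real C = _
    field_simp
  have hlip : ∀ a b : E, φ a - φ b ≤ dist a b := fun a b => by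
    rw [← map_sub, dist_eq_norm]
    refine (le_abs_self _).trans ?_
    rw [← Real.norm_eq_abs]
    exact (φ.le_of_opNorm_le hφ _).trans (by rw [one_mul])
  have hCne : C.Nonempty := by
    by_contra hE
    rw [not_nonempty_iff_eq_empty] at hE
    exact hC0 (by rw [hE]; simp)
  obtain ⟨y, hy, hymin⟩ := hCc.exists_isMinOn hCne φ.continuous.continuousOn
  have hsupp : ν (Icc (φ y) (φ y + Metric.diam K))ᶜ = 0 := by
    rw [← measureReal_eq_zero_iff]
    have h1 := hνr _ (measurableSet_Icc (a := φ y) (b := φ y + Metric.diam K)).compl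
    have h2 : C ∩ φ ⁻¹' (Icc (φ y) (φ y + Metric.diam K))ᶜ = ∅ := by
      ext q
      simp only [mem_inter_iff, mem_preimage, mem_compl_iff, mem_empty_iff_false, iff_false,
        not_and, not_not]
      intro hq
      have h3 := hlip q y
      have h4 := Metric.dist_le_diam_of_mem hKc.isBounded (hCK hq) (hCK hy)
      exact mem_Icc.2 ⟨hymin hq, by linarith⟩
    rw [h2, measureReal_empty] at h1
    exact (mul_eq_zero.1 h1).resolve_right hCpos.ne'
  have hA : IsCompact (φ '' (S ∩ C)) := (hS.inter hCc).image φ.continuous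
  have h1d := profile_le_cthickening_real hνl hk hr0 hDr hsupp hA
  have hx : μ.real S ≤ ν.real (φ '' (S ∩ C)) := by
    refine le_of_mul_le_mul_right ?_ hCpos
    rw [hνr _ hA.measurableSet, ← hSC]
    exact measureReal_mono fun q hq => ⟨hq.2, mem_image_of_mem _ hq⟩
  have hT : ν.real (Metric.cthickening r (φ '' (S ∩ C))) * μ.real C
      ≤ μ.real (Metric.cthickening h S ∩ C) := by
    rw [hνr _ Metric.isClosed_cthickening.measurableSet]
    refine measureReal_mono ?_
    rintro q ⟨hqC, hq⟩
    rw [mem_preimage, hA.cthickening_eq_biUnion_closedBall hr0.le] at hq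
    simp only [mem_iUnion, Metric.mem_closedBall, Real.dist_eq, exists_prop, mem_image] at hq
    obtain ⟨_, ⟨s, hs, rfl⟩, hqs⟩ := hq
    refine ⟨Metric.mem_cthickening_of_dist_le q s h S hs.1 ?_, hqC⟩
    have := hthin q hqC s hs.2
    rw [dist_eq_norm]; linarith
  have h2 := profile_mono k measureReal_nonneg hx
  have h3 : profile k (μ.real S) * μ.real C
      ≤ ν.real (Metric.cthickening r (φ '' (S ∩ C))) * μ.real C := by
    gcongr; exact h2.trans h1d
  linarith

/-- The discrete inequality for arbitrary sets, by inner regularity. -/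
lemma profile_sub_le {μ : Measure E} [IsProbabilityMeasure μ] (hμ : IsLogConcaveMeasure μ)
    {K : Set E} (hKc : IsCompact K) (hKv : Convex ℝ K) (hμK : μ Kᶜ = 0) {S : Set E}
    (hS : NullMeasurableSet S μ) (hSK : S ⊆ K) (hS0 : 0 < μ.real S) {k : ℕ} (hk : 2 ≤ k) {h : ℝ}
    (hD : Metric.diam K < k * h) :
    profile k (μ.real S) - μ.real S ≤ μ.real (Metric.cthickening h S \ S) := by
  have := FiniteDimensional.proper ℝ E
  have hsub : profile k (μ.real S) ≤ μ.real (Metric.cthickening h S) := by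
    obtain ⟨S', hS'S, hS'm, hS'e⟩ := hS.exists_measurable_subset_ae_eq
    have hS'r : μ.real S' = μ.real S := measureReal_congr hS'e
    have key : ∀ c, 0 < c → c < μ.real S →
        c / μ.real S * profile k (μ.real S) ≤ μ.real (Metric.cthickening h S) := by
      intro c hc0 hc
      have hlt : ENNReal.ofReal c < μ S' := by
        rw [← ofReal_measureReal, hS'r, ENNReal.ofReal_lt_ofReal_iff hS0]; exact hc
      obtain ⟨S'', hsub, hcomp, hlt'⟩ := hS'm.exists_lt_isCompact hlt
      have h1 := profile_le_cthickening hμ hKc hKv hμK hcomp ((hsub.trans hS'S).trans hSK) hk hD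
      have h2 : c ≤ μ.real S'' := by
        rw [← ofReal_measureReal] at hlt'
        exact ((ENNReal.ofReal_lt_ofReal_iff'.1 hlt').1).le
      calc _ ≤ profile k c := profile_scale k hc0.le hS0 hc.le
        _ ≤ profile k (μ.real S'') := profile_mono k hc0.le h2
        _ ≤ _ := h1
        _ ≤ _ := measureReal_mono (Metric.cthickening_subset_of_subset h (hsub.trans hS'S))
    have hlim : Tendsto (fun c => c / μ.real S * profile k (μ.real S)) (𝓝[<] (μ.real S))
        (𝓝 (profile k (μ.real S))) := by
      have hc : Continuous fun c => c / μ.real S * profile k (μ.real S) := by fun_prop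
      have := (hc.tendsto (μ.real S)).mono_left (nhdsWithin_le_nhds (s := Iio (μ.real S)))
      rwa [div_self hS0.ne', one_mul] at this
    refine le_of_tendsto hlim ?_
    filter_upwards [Ioo_mem_nhdsLT hS0] with c hc using key c hc.1 hc.2
  have h2 : μ.real (Metric.cthickening h S) ≤ μ.real (Metric.cthickening h S \ S) + μ.real S :=
    (measureReal_mono (by rw [sdiff_union_self]; exact subset_union_left)).trans
      (measureReal_union_le _ _)
  linarith

lemma mul_isoG_le_minkowskiMeasure {μ : Measure E} [IsProbabilityMeasure μ]
    (hμ : IsLogConcaveMeasure μ) {K : Set E} (hKc : IsCompact K) (hKv : Convex ℝ K)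
    (hμK : μ Kᶜ = 0) {S : Set E} (hS : NullMeasurableSet S μ) (hSK : S ⊆ K)
    (hS1 : μ S ≤ 1 / 2) :
    ENNReal.ofReal (μ.real S * isoG (1 / μ.real S)) ≤
      ENNReal.ofReal (Metric.diam K) * minkowskiMeasure μ S := by
  set x := μ.real S with hx
  have hx2 : x ≤ 1 / 2 := by
    have := ENNReal.toReal_mono (by norm_num) hS1
    simpa [hx, measureReal_def] using this
  rcases (measureReal_nonneg : 0 ≤ μ.real S).eq_or_lt with h0 | h0
  · rw [hx, ← h0]; simp
  have hxI : x ∈ Ioc (0 : ℝ) (1 / 2) := ⟨h0, hx2⟩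
  rcases (Metric.diam_nonneg (s := K)).eq_or_lt with hD | hD
  · -- If `K` has diameter zero, then `μ` is a point mass and `μ S ∈ {0, 1}`.
    exfalso
    have hKS : K ⊆ S := by
      obtain ⟨s, hs⟩ : S.Nonempty := by
        by_contra hE
        rw [not_nonempty_iff_eq_empty] at hE
        rw [hE] at h0; simp at h0
      intro q hq
      have := Metric.dist_le_diam_of_mem hKc.isBounded hq (hSK hs)
      rw [← hD] at this
      rwa [dist_le_zero.1 this]
    have h1 : μ.real K = 1 := by
      rw [measureReal_def, (prob_compl_eq_zero_iff hKc.measurableSet).1 hμK]; simp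
    have h2 : μ.real K ≤ x := measureReal_mono hKS
    linarith
  set D := Metric.diam K
  set J := x * isoG (1 / x)
  have hJ0 : 0 ≤ J := mul_isoG_nonneg hxI
  -- The inequality at distance `h`, where `k` is the least integer with `D < k h`.
  have key : ∀ h : ℝ, 0 < h → h < D → (1 - h / D) * Real.exp (-(2 / (D / h))) * (J / D) ≤
      μ.real (Metric.cthickening h S \ S) / h := by
    intro h hh0 hhD
    set k := ⌊D / h⌋₊ + 1
    have hk1 : D / h < k := by push_cast [k]; exact Nat.lt_floor_add_one _
    have hk2 : (k : ℝ) ≤ D / h + 1 := by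
      push_cast [k]; linarith [Nat.floor_le (show 0 ≤ D / h by positivity)]
    have hDh : 0 < D / h := by positivity
    have hk : 2 ≤ k := by
      have : 1 ≤ ⌊D / h⌋₊ := Nat.le_floor (by rw [Nat.cast_one, one_le_div hh0]; exact hhD.le)
      omega
    have hk0 : (0 : ℝ) < k := by positivity
    have h1 := profile_sub_le hμ hKc hKv hμK hS hSK h0 hk (h := h) (by
      rwa [div_lt_iff₀ hh0] at hk1)
    have h2 := add_le_profile hk hxI hJ0 (mul_isoG_le_one hxI)
      (fun γ hγ => mul_isoG_le_exponential hxI hγ)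
    have hexp : Real.exp (-(2 / (D / h))) ≤ Real.exp (-(2 / (k : ℝ))) := by
      rw [Real.exp_le_exp]
      have : 2 / (k : ℝ) ≤ 2 / (D / h) := by gcongr
      linarith
    have hfrac : (1 - h / D) * (h / D) ≤ 1 / k := by
      have e1 : 1 / (D / h + 1) ≤ 1 / k := by gcongr
      refine le_trans ?_ e1
      have e2 : h / D = (D / h)⁻¹ := by rw [inv_div]
      rw [e2]
      generalize D / h = a at *
      rw [le_div_iff₀ (by linarith)]
      have : (1 - a⁻¹) * a⁻¹ * (a + 1) = 1 - a⁻¹ ^ 2 := by field_simp; ring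
      rw [this]; nlinarith [sq_nonneg a⁻¹]
    rw [le_div_iff₀ hh0]
    calc (1 - h / D) * Real.exp (-(2 / (D / h))) * (J / D) * h
        = Real.exp (-(2 / (D / h))) * J * ((1 - h / D) * (h / D)) := by ring
      _ ≤ Real.exp (-(2 / (D / h))) * J * (1 / k) := by gcongr
      _ ≤ Real.exp (-(2 / (k : ℝ))) * J * (1 / k) := by gcongr
      _ = Real.exp (-(2 / (k : ℝ))) * J / k := by ring
      _ ≤ _ := by linarith
  have hlim : Tendsto (fun h : ℝ => ENNReal.ofReal
      ((1 - h / D) * Real.exp (-(2 / (D / h))) * (J / D))) (𝓝[>] 0)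
      (𝓝 (ENNReal.ofReal (J / D))) := by
    refine (ENNReal.continuous_ofReal.tendsto _).comp ?_
    have hc : Continuous fun h : ℝ => (1 - h / D) * Real.exp (-(2 * h / D)) * (J / D) := by
      fun_prop
    have := (hc.tendsto 0).mono_left (nhdsWithin_le_nhds (s := Ioi 0))
    simp only [zero_div, sub_zero, mul_zero, neg_zero, Real.exp_zero, one_mul] at this
    refine this.congr fun h => ?_
    rw [div_div_eq_mul_div]
  have hmink : ENNReal.ofReal (J / D) ≤ minkowskiMeasure μ S := by
    rw [← hlim.liminf_eq]
    refine liminf_le_liminf ?_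
    filter_upwards [Ioo_mem_nhdsGT hD] with h hh
    rw [minkowskiQuotient, ← ofReal_measureReal, ← ENNReal.ofReal_div_of_pos hh.1]
    exact ENNReal.ofReal_le_ofReal (key h hh.1 hh.2)
  calc ENNReal.ofReal J = ENNReal.ofReal D * ENNReal.ofReal (J / D) := by
        rw [← ENNReal.ofReal_mul hD.le]; congr 1; field_simp
    _ ≤ _ := by gcongr

end Isoperimetry

/-! ### The Prékopa–Leindler inequality -/

lemma volume_add_le_volume_add {A B : Set ℝ} (hA : IsCompact A) (hB : IsCompact B)
    (hA0 : A.Nonempty) (hB0 : B.Nonempty) : volume A + volume B ≤ volume (A + B) := by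
  -- `A + min B` and `max A + B` meet in a single point.
  obtain ⟨a, ha, hamax⟩ := hA.exists_isGreatest hA0
  obtain ⟨b, hb, hbmin⟩ := hB.exists_isLeast hB0
  have h1 : volume ((fun x => x + b) '' A) = volume A := by simp
  have h2 : volume ((fun x => a + x) '' B) = volume B := by simp
  have hd : AEDisjoint volume ((fun x => x + b) '' A) ((fun x => a + x) '' B) := by
    refine measure_mono_null (t := {a + b}) ?_ (by simp)
    rintro _ ⟨⟨x, hx, rfl⟩, ⟨y, hy, hxy⟩⟩
    have := hamax hx
    have := hbmin hy
    simp only at hxy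
    rw [mem_singleton_iff]
    simp only
    linarith
  have hBm : MeasurableSet ((fun x => a + x) '' B) :=
    (hB.image (by fun_prop)).measurableSet
  rw [← h1, ← h2, ← measure_union₀ hBm.nullMeasurableSet hd]
  refine measure_mono (union_subset ?_ ?_)
  · rintro _ ⟨x, hx, rfl⟩; exact add_mem_add hx hb
  · rintro _ ⟨x, hx, rfl⟩; exact add_mem_add ha hx

lemma volume_add_le_of_forall_compact {A : Set ℝ} (hA : MeasurableSet A) (hA0 : A.Nonempty)
    {c m : ℝ≥0∞} (h : ∀ K ⊆ A, IsCompact K → K.Nonempty → volume K + c ≤ m) :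
    volume A + c ≤ m := by
  obtain ⟨a, ha⟩ := hA0
  have hc : c ≤ m := by
    simpa using h {a} (singleton_subset_iff.2 ha) isCompact_singleton (singleton_nonempty a)
  rcases eq_or_ne c ∞ with rfl | hc'
  · rw [top_le_iff.1 hc]; exact le_top
  by_contra! hlt
  obtain ⟨K, hKA, hK, hKv⟩ := hA.exists_lt_isCompact
    (ENNReal.sub_lt_of_lt_add hc (by rwa [add_comm] at hlt ⊢))
  have hne : K.Nonempty := by
    by_contra hE
    rw [not_nonempty_iff_eq_empty] at hE
    rw [hE] at hKv; simp at hKv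
  exact absurd (ENNReal.le_sub_of_add_le_right hc' (h K hKA hK hne)) hKv.not_ge

/-- The Brunn–Minkowski inequality on the line. -/
lemma mul_volume_add_le {A B M : Set ℝ} (hA : MeasurableSet A) (hB : MeasurableSet B)
    (hA0 : A.Nonempty) (hB0 : B.Nonempty) {t : ℝ} (ht : t ∈ Ioo (0 : ℝ) 1)
    (hM : ∀ x ∈ A, ∀ y ∈ B, t * x + (1 - t) * y ∈ M) :
    ENNReal.ofReal t * volume A + ENNReal.ofReal (1 - t) * volume B ≤ volume M := by
  have ht0 := ht.1
  have ht1 : 0 < 1 - t := by linarith [ht.2]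
  have hs : ∀ {s : ℝ}, 0 < s → ∀ X : Set ℝ, volume (s • X) = ENNReal.ofReal s * volume X :=
    fun {s} hs X => by rw [Measure.addHaar_smul]; simp [abs_of_pos hs]
  rw [← hs ht0, ← hs ht1]
  refine volume_add_le_of_forall_compact (hA.const_smul_of_ne_zero ht0.ne') (hA0.smul_set)
    fun K hK hKc hK0 => ?_
  rw [add_comm]
  refine volume_add_le_of_forall_compact (hB.const_smul_of_ne_zero ht1.ne') (hB0.smul_set)
    fun L hL hLc hL0 => ?_
  rw [add_comm]
  refine (volume_add_le_volume_add hKc hLc hK0 hL0).trans (measure_mono ?_)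
  rintro _ ⟨x, hx, y, hy, rfl⟩
  obtain ⟨x', hx', rfl⟩ := hK hx
  obtain ⟨y', hy', rfl⟩ := hL hy
  exact hM x' hx' y' hy'

lemma ENNReal.rpow_mul_rpow_le_add (a b : ℝ≥0∞) {t : ℝ} (ht : t ∈ Ioo (0 : ℝ) 1) :
    a ^ t * b ^ (1 - t) ≤ ENNReal.ofReal t * a + ENNReal.ofReal (1 - t) * b := by
  have ht0 := ht.1
  have ht1 : 0 < 1 - t := by linarith [ht.2]
  rcases eq_or_ne a ∞ with rfl | ha
  · rw [ENNReal.mul_top (by simpa using ht0), top_add]; exact le_top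
  rcases eq_or_ne b ∞ with rfl | hb
  · rw [ENNReal.mul_top (by simpa using ht.2), add_top]; exact le_top
  rw [← ENNReal.ofReal_toReal ha, ← ENNReal.ofReal_toReal hb,
    ENNReal.ofReal_rpow_of_nonneg ENNReal.toReal_nonneg ht0.le,
    ENNReal.ofReal_rpow_of_nonneg ENNReal.toReal_nonneg ht1.le,
    ← ENNReal.ofReal_mul (by positivity), ← ENNReal.ofReal_mul ht0.le, ← ENNReal.ofReal_mul ht1.le,
    ← ENNReal.ofReal_add (by positivity) (by positivity)]
  exact ENNReal.ofReal_le_ofReal (Real.geom_mean_le_arith_mean2_weighted ht0.le ht1.le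
    ENNReal.toReal_nonneg ENNReal.toReal_nonneg (by ring))

/-- Functions with equal suprema satisfy the stronger, additive form of the Prékopa–Leindler
inequality, by the Brunn–Minkowski inequality for their superlevel sets. -/
lemma mul_lintegral_add_le {f g h : ℝ → ℝ} (hf : Measurable f) (hg : Measurable g)
    (hh : Measurable h) (hf0 : ∀ x, 0 ≤ f x) (hg0 : ∀ x, 0 ≤ g x) (hh0 : ∀ x, 0 ≤ h x)
    (hf1 : ∀ x, f x ≤ 1) (hg1 : ∀ x, g x ≤ 1) (hfs : ∀ s < 1, ∃ x, s < f x)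
    (hgs : ∀ s < 1, ∃ x, s < g x) {t : ℝ} (ht : t ∈ Ioo (0 : ℝ) 1)
    (hfgh : ∀ x y, f x ^ t * g y ^ (1 - t) ≤ h (t * x + (1 - t) * y)) :
    ENNReal.ofReal t * (∫⁻ x, ENNReal.ofReal (f x)) + ENNReal.ofReal (1 - t) *
      (∫⁻ x, ENNReal.ofReal (g x)) ≤ ∫⁻ x, ENNReal.ofReal (h x) := by
  have hm : ∀ u : ℝ → ℝ, Measurable fun s : ℝ => volume {x | s < u x} := fun u =>
    Antitone.measurable fun s s' hs => measure_mono fun x (hx : s' < u x) => hs.trans_lt hx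
  rw [lintegral_eq_lintegral_meas_lt _ (Eventually.of_forall hf0) hf.aemeasurable,
    lintegral_eq_lintegral_meas_lt _ (Eventually.of_forall hg0) hg.aemeasurable,
    lintegral_eq_lintegral_meas_lt _ (Eventually.of_forall hh0) hh.aemeasurable,
    ← lintegral_const_mul _ (hm f), ← lintegral_const_mul _ (hm g),
    ← lintegral_add_left ((hm f).const_mul _)]
  refine setLIntegral_mono (hm h) fun s hs => ?_
  have hs : 0 < s := hs
  rcases lt_or_ge s 1 with hs1 | hs1
  · refine mul_volume_add_le (measurableSet_lt measurable_const hf)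
      (measurableSet_lt measurable_const hg) (hfs s hs1) (hgs s hs1) ht fun x hx y hy => ?_
    have hx : s < f x := hx
    have hy : s < g y := hy
    have ht1 : 0 < 1 - t := by linarith [ht.2]
    refine lt_of_lt_of_le ?_ (hfgh x y)
    calc s = s ^ t * s ^ (1 - t) := by rw [← Real.rpow_add hs]; simp
      _ < f x ^ t * g y ^ (1 - t) := by
        have := ht.1
        exact mul_lt_mul'' (Real.rpow_lt_rpow hs.le hx ht.1) (Real.rpow_lt_rpow hs.le hy ht1)
          (by positivity) (by positivity)
  · have e1 : {x | s < f x} = ∅ := by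
      ext x; simpa using (hf1 x).trans hs1
    have e2 : {x | s < g x} = ∅ := by
      ext x; simpa using (hg1 x).trans hs1
    simp [e1, e2]

lemma prekopa_leindler_of_bounded {f g h : ℝ → ℝ≥0∞} (hf : Measurable f) (hg : Measurable g)
    (hh : Measurable h) {t : ℝ} (ht : t ∈ Ioo (0 : ℝ) 1)
    (hfb : ⨆ x, f x ≠ ∞) (hgb : ⨆ x, g x ≠ ∞)
    (hfgh : ∀ x y, f x ^ t * g y ^ (1 - t) ≤ h (t * x + (1 - t) * y)) :
    (∫⁻ x, f x) ^ t * (∫⁻ x, g x) ^ (1 - t) ≤ ∫⁻ x, h x := by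
  have ht0 := ht.1
  have ht1 : 0 < 1 - t := by linarith [ht.2]
  set F := ⨆ x, f x with hF
  set G := ⨆ x, g x with hG
  rcases eq_or_ne F 0 with hF0 | hF0
  · have : ∀ x, f x = 0 := fun x => le_antisymm ((le_iSup f x).trans hF0.le) zero_le
    simp [this, ENNReal.zero_rpow_of_pos ht0]
  rcases eq_or_ne G 0 with hG0 | hG0
  · have : ∀ x, g x = 0 := fun x => le_antisymm ((le_iSup g x).trans hG0.le) zero_le
    simp [this, ENNReal.zero_rpow_of_pos ht1]
  -- Normalize both suprema to `1`, and truncate `h` correspondingly.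
  set H := F ^ t * G ^ (1 - t) with hH
  have hH0 : H ≠ 0 := mul_ne_zero (ENNReal.rpow_pos (pos_iff_ne_zero.2 hF0) hfb).ne'
    (ENNReal.rpow_pos (pos_iff_ne_zero.2 hG0) hgb).ne'
  have hHt : H ≠ ∞ := ENNReal.mul_ne_top (ENNReal.rpow_ne_top_of_nonneg ht0.le hfb)
    (ENNReal.rpow_ne_top_of_nonneg ht1.le hgb)
  have hsup : ∀ {u : ℝ → ℝ≥0∞}, (⨆ x, u x) ≠ 0 → (⨆ x, u x) ≠ ∞ →
      (∀ x, u x / (⨆ x, u x) ≤ 1) ∧ ∀ s : ℝ, s < 1 → ∃ x, s < (u x / (⨆ x, u x)).toReal := by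
    intro u hu0 hut
    have hle : ∀ x, u x / (⨆ x, u x) ≤ 1 := fun x =>
      ENNReal.div_le_of_le_mul (by rw [one_mul]; exact le_iSup u x)
    refine ⟨hle, fun s hs => ?_⟩
    rcases lt_or_ge s 0 with h0 | h0
    · exact ⟨0, h0.trans_le ENNReal.toReal_nonneg⟩
    have h1 : ENNReal.ofReal s * (⨆ x, u x) < ⨆ x, u x := by
      conv_rhs => rw [← one_mul (⨆ x, u x)]
      exact ENNReal.mul_lt_mul_left hu0 hut (by
        rw [← ENNReal.ofReal_one]; exact ENNReal.ofReal_lt_ofReal_iff one_pos |>.2 hs)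
    obtain ⟨x, hx⟩ := lt_iSup_iff.1 h1
    refine ⟨x, ?_⟩
    rw [← ENNReal.ofReal_lt_iff_lt_toReal h0 (ne_top_of_le_ne_top ENNReal.one_ne_top (hle x))]
    exact (ENNReal.lt_div_iff_mul_lt (Or.inl hu0) (Or.inl hut)).2 hx
  obtain ⟨hf1, hfs⟩ := hsup hF0 hfb
  obtain ⟨hg1, hgs⟩ := hsup hG0 hgb
  have hft : ∀ x, f x / F ≠ ∞ := fun x => ne_top_of_le_ne_top ENNReal.one_ne_top (hf1 x)
  have hgt : ∀ x, g x / G ≠ ∞ := fun x => ne_top_of_le_ne_top ENNReal.one_ne_top (hg1 x)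
  have hht : ∀ x, min (h x / H) 1 ≠ ∞ := fun x =>
    ne_top_of_le_ne_top ENNReal.one_ne_top (min_le_right _ _)
  have key := mul_lintegral_add_le (f := fun x => (f x / F).toReal) (g := fun x => (g x / G).toReal)
    (h := fun x => (min (h x / H) 1).toReal) (hf.div_const F).ennreal_toReal
    (hg.div_const G).ennreal_toReal ((hh.div_const H).min measurable_const).ennreal_toReal
    (fun _ => ENNReal.toReal_nonneg) (fun _ => ENNReal.toReal_nonneg)
    (fun _ => ENNReal.toReal_nonneg)
    (fun x => by simpa using ENNReal.toReal_mono ENNReal.one_ne_top (hf1 x))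
    (fun x => by simpa using ENNReal.toReal_mono ENNReal.one_ne_top (hg1 x)) hfs hgs ht
    (fun x y => by
      rw [ENNReal.toReal_rpow, ENNReal.toReal_rpow, ← ENNReal.toReal_mul]
      refine ENNReal.toReal_mono (hht _) (le_min ?_ ?_)
      · rw [ENNReal.div_rpow_of_nonneg _ _ ht0.le, ENNReal.div_rpow_of_nonneg _ _ ht1.le,
          div_eq_mul_inv, div_eq_mul_inv, mul_mul_mul_comm, ← ENNReal.mul_inv, ← div_eq_mul_inv]
        · exact ENNReal.div_le_div_right (hfgh x y) _
        · exact Or.inr (ENNReal.rpow_ne_top_of_nonneg ht1.le hgb)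
        · exact Or.inl (ENNReal.rpow_ne_top_of_nonneg ht0.le hfb)
      · exact mul_le_one' (ENNReal.rpow_le_one (hf1 x) ht0.le) (ENNReal.rpow_le_one (hg1 y) ht1.le))
  simp only [ENNReal.ofReal_toReal (hft _), ENNReal.ofReal_toReal (hgt _),
    ENNReal.ofReal_toReal (hht _)] at key
  have h1 := (ENNReal.rpow_mul_rpow_le_add (∫⁻ x, f x / F) (∫⁻ x, g x / G) ht).trans
    (key.trans (lintegral_mono fun x => min_le_left _ _))
  simp only [div_eq_mul_inv] at h1
  rw [lintegral_mul_const _ hf, lintegral_mul_const _ hg, lintegral_mul_const _ hh,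
    ENNReal.mul_rpow_of_nonneg _ _ ht0.le, ENNReal.mul_rpow_of_nonneg _ _ ht1.le,
    mul_mul_mul_comm, ENNReal.inv_rpow, ENNReal.inv_rpow, ← ENNReal.mul_inv
      (Or.inr (ENNReal.rpow_ne_top_of_nonneg ht1.le hgb))
      (Or.inl (ENNReal.rpow_ne_top_of_nonneg ht0.le hfb))] at h1
  exact (ENNReal.mul_le_mul_iff_left (ENNReal.inv_ne_zero.2 hHt) (ENNReal.inv_ne_top.2 hH0)).1 h1

lemma prekopa_leindler_real {f g h : ℝ → ℝ≥0∞} (hf : Measurable f) (hg : Measurable g)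
    (hh : Measurable h) {t : ℝ} (ht : t ∈ Ioo (0 : ℝ) 1)
    (hfgh : ∀ x y, f x ^ t * g y ^ (1 - t) ≤ h (t * x + (1 - t) * y)) :
    (∫⁻ x, f x) ^ t * (∫⁻ x, g x) ^ (1 - t) ≤ ∫⁻ x, h x := by
  have ht0 := ht.1
  have ht1 : 0 < 1 - t := by linarith [ht.2]
  rcases eq_or_ne (∫⁻ x, f x) 0 with hF0 | hF0
  · simp [hF0, ENNReal.zero_rpow_of_pos ht0]
  rcases eq_or_ne (∫⁻ x, g x) 0 with hG0 | hG0
  · simp [hG0, ENNReal.zero_rpow_of_pos ht1]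
  have htend : ∀ {u : ℝ → ℝ≥0∞}, Measurable u →
      Tendsto (fun N : ℕ => ∫⁻ x, min (u x) N) atTop (𝓝 (∫⁻ x, u x)) := by
    intro u hu
    refine lintegral_tendsto_of_tendsto_of_monotone
      (fun N => (hu.min measurable_const).aemeasurable)
      (Eventually.of_forall fun x N M hNM => min_le_min_left _ (by exact_mod_cast hNM))
      (Eventually.of_forall fun x => ?_)
    have := (tendsto_const_nhds (x := u x) (f := (atTop : Filter ℕ))).min
      ENNReal.tendsto_nat_nhds_top
    simpa using this
  have hb : ∀ (u : ℝ → ℝ≥0∞) (N : ℕ), ⨆ x, min (u x) N ≠ ∞ := fun u N =>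
    ne_top_of_le_ne_top (ENNReal.natCast_ne_top N) (iSup_le fun x => min_le_right _ _)
  have hlim := ENNReal.Tendsto.mul
    ((ENNReal.continuous_rpow_const (y := t)).continuousAt.tendsto.comp (htend hf))
    (Or.inl (fun h => hF0 ((ENNReal.rpow_eq_zero_iff_of_pos ht0).1 h)))
    ((ENNReal.continuous_rpow_const (y := 1 - t)).continuousAt.tendsto.comp (htend hg))
    (Or.inl (fun h => hG0 ((ENNReal.rpow_eq_zero_iff_of_pos ht1).1 h)))
  refine le_of_tendsto' hlim fun N => ?_
  refine prekopa_leindler_of_bounded (hf.min measurable_const) (hg.min measurable_const) hh ht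
    (hb f N) (hb g N) fun x y => le_trans ?_ (hfgh x y)
  gcongr
  · exact min_le_left _ _
  · exact min_le_left _ _

lemma measurable_finCons (n : ℕ) :
    Measurable fun p : ℝ × (Fin n → ℝ) => (Fin.cons p.1 p.2 : Fin (n + 1) → ℝ) := by
  refine measurable_pi_lambda _ fun i => ?_
  refine Fin.cases ?_ (fun j => ?_) i
  · simpa using measurable_fst
  · simpa [Function.comp_def] using (measurable_pi_apply j).comp measurable_snd

lemma lintegral_finCons {n : ℕ} {f : (Fin (n + 1) → ℝ) → ℝ≥0∞} (hf : Measurable f) :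
    ∫⁻ z, f z = ∫⁻ x : ℝ, ∫⁻ y : Fin n → ℝ, f (Fin.cons x y) := by
  have h := (volume_preserving_piFinSuccAbove (fun _ : Fin (n + 1) => ℝ) 0).symm
  rw [← h.lintegral_comp hf]
  have hfm : Measurable fun p : ℝ × (Fin n → ℝ) => f (Fin.cons p.1 p.2) :=
    hf.comp (measurable_finCons n)
  have := lintegral_prod (μ := (volume : Measure ℝ)) (ν := (volume : Measure (Fin n → ℝ))) _
    hfm.aemeasurable
  rw [← this, ← Measure.volume_eq_prod]
  refine lintegral_congr fun p => congrArg f ?_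
  ext i
  refine Fin.cases ?_ (fun j => ?_) i <;> simp [MeasurableEquiv.piFinSuccAbove]

/-- The Prékopa–Leindler inequality, by induction on the dimension: the marginals of `f`, `g`, `h`
inherit the hypothesis. -/
lemma prekopa_leindler {n : ℕ} {f g h : (Fin n → ℝ) → ℝ≥0∞} (hf : Measurable f)
    (hg : Measurable g) (hh : Measurable h) {t : ℝ} (ht : t ∈ Ioo (0 : ℝ) 1)
    (hfgh : ∀ x y, f x ^ t * g y ^ (1 - t) ≤ h (t • x + (1 - t) • y)) :
    (∫⁻ x, f x) ^ t * (∫⁻ x, g x) ^ (1 - t) ≤ ∫⁻ x, h x := by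
  induction n with
  | zero =>
    simp only [lintegral_unique, volume_pi, Measure.pi_empty_univ, mul_one]
    convert hfgh default default
  | succ n ih =>
    rw [lintegral_finCons hf, lintegral_finCons hg, lintegral_finCons hh]
    have hc := measurable_finCons n
    refine prekopa_leindler_real (hf.comp hc).lintegral_prod_right'
      (hg.comp hc).lintegral_prod_right'
      (hh.comp hc).lintegral_prod_right' ht fun x y => ?_
    refine ih (hf.comp (hc.comp measurable_prodMk_left)) (hg.comp (hc.comp measurable_prodMk_left))
      (hh.comp (hc.comp measurable_prodMk_left)) fun v w => ?_
    refine (hfgh _ _).trans (le_of_eq ?_)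
    congr 1
    ext i
    refine Fin.cases ?_ (fun j => ?_) i <;> simp

lemma rpow_mul_le_of_forall_compact {n : ℕ} {μ : Measure (Fin n → ℝ)} [IsFiniteMeasure μ]
    {A : Set (Fin n → ℝ)} (hA : MeasurableSet A) {t : ℝ} (ht : 0 < t) {c m : ℝ≥0∞} (hc : c ≠ ∞)
    (h : ∀ K ⊆ A, IsCompact K → μ K ^ t * c ≤ m) : μ A ^ t * c ≤ m := by
  rcases eq_or_ne (μ A) 0 with h0 | h0
  · simp [h0, ENNReal.zero_rpow_of_pos ht]
  have hcont : Continuous fun a : ℝ≥0∞ => a ^ t * c :=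
    (ENNReal.continuous_mul_const hc).comp ENNReal.continuous_rpow_const
  by_contra! hlt
  obtain ⟨l, hl, hsub⟩ := exists_Ioc_subset_of_mem_nhds
    (hcont.continuousAt.eventually (lt_mem_nhds hlt)) ⟨0, pos_iff_ne_zero.2 h0⟩
  obtain ⟨K, hKA, hK, hlK⟩ := hA.exists_lt_isCompact hl
  exact absurd (h K hKA hK) (hsub ⟨hlK, measure_mono hKA⟩).not_ge

lemma isLogConcaveMeasure_withDensity {n : ℕ} {g : (Fin n → ℝ) → ℝ≥0∞} (hg : Measurable g)
    [IsFiniteMeasure (volume.withDensity g)]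
    (hlc : ∀ t ∈ Ioo (0 : ℝ) 1, ∀ x y, g x ^ t * g y ^ (1 - t) ≤ g (t • x + (1 - t) • y)) :
    IsLogConcaveMeasure (volume.withDensity g) := by
  intro A B hA hB t ht
  have ht0 := ht.1
  have ht1 : 0 < 1 - t := by linarith [ht.2]
  refine rpow_mul_le_of_forall_compact hA ht0
    (ENNReal.rpow_ne_top_of_nonneg ht1.le (measure_ne_top _ _)) fun K hKA hK => ?_
  rw [mul_comm]
  refine rpow_mul_le_of_forall_compact hB ht1
    (ENNReal.rpow_ne_top_of_nonneg ht0.le (measure_ne_top _ _)) fun L hLB hL => ?_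
  rw [mul_comm]
  have hM : IsCompact (t • K + (1 - t) • L) := (hK.smul t).add (hL.smul (1 - t))
  refine le_trans ?_ (measure_mono (add_subset_add (smul_set_mono hKA) (smul_set_mono hLB)))
  rw [withDensity_apply _ hK.measurableSet, withDensity_apply _ hL.measurableSet,
    withDensity_apply _ hM.measurableSet, ← lintegral_indicator hK.measurableSet,
    ← lintegral_indicator hL.measurableSet, ← lintegral_indicator hM.measurableSet]
  refine prekopa_leindler (hg.indicator hK.measurableSet) (hg.indicator hL.measurableSet)
    (hg.indicator hM.measurableSet) ht fun x y => ?_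
  by_cases hx : x ∈ K
  · by_cases hy : y ∈ L
    · rw [indicator_of_mem hx, indicator_of_mem hy, indicator_of_mem
        (Set.add_mem_add (smul_mem_smul_set hx) (smul_mem_smul_set hy))]
      exact hlc t ht x y
    · rw [indicator_of_notMem hy, ENNReal.zero_rpow_of_pos ht1, mul_zero]; exact zero_le
  · rw [indicator_of_notMem hx, ENNReal.zero_rpow_of_pos ht0, zero_mul]; exact zero_le

/-! ### Thin cylinders -/

/-- The first basis vector is normed by the first coordinate functional, and the others are unit
vectors in its kernel. -/
lemma exists_unit_basis_abs_repr_zero_le {E : Type*} [NormedAddCommGroup E] [NormedSpace ℝ E]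
    [FiniteDimensional ℝ E] {n : ℕ} (hn : Module.finrank ℝ E = n + 1) :
    ∃ b : Module.Basis (Fin (n + 1)) ℝ E, (∀ i, ‖b i‖ = 1) ∧ ∀ z, |b.repr z 0| ≤ ‖z‖ := by
  have : Nontrivial E := Module.nontrivial_of_finrank_pos (R := ℝ) (by omega)
  obtain ⟨v, hv⟩ := exists_norm_eq E zero_le_one
  obtain ⟨φ, hφ1, hφv⟩ := exists_dual_vector'' ℝ v
  have hφv : φ v = 1 := by rw [hφv, hv]; rfl
  set N := LinearMap.ker (φ : E →ₗ[ℝ] ℝ)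
  have hN : Module.finrank ℝ N = n := by
    have h1 := (φ : E →ₗ[ℝ] ℝ).finrank_range_add_finrank_ker
    have h2 : LinearMap.range (φ : E →ₗ[ℝ] ℝ) = ⊤ :=
      LinearMap.range_eq_top.2 fun c => ⟨c • v, by simp [hφv]⟩
    rw [h2, finrank_top, Module.finrank_self, hn] at h1
    change 1 + Module.finrank ℝ N = n + 1 at h1
    omega
  let c := Module.finBasisOfFinrankEq ℝ N hN
  have hc : ∀ i, ‖c i‖ ≠ 0 := fun i => norm_ne_zero_iff.2 (c.ne_zero i)
  let c' := c.unitsSMul fun i => Units.mk0 (‖c i‖⁻¹) (inv_ne_zero (hc i))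
  let b := Module.Basis.mkFinCons v c'
    (fun a x hx h => by
      have hx : φ x = 0 := hx
      have := congrArg φ h
      simpa [hφv, hx] using this)
    (fun z => ⟨-φ z, by
      change φ (z + -φ z • v) = 0
      simp [hφv]⟩)
  have hb0 : b 0 = v := by simp [b]
  have hbs : ∀ i : Fin n, b i.succ = (c' i : E) := fun i => by simp [b]
  refine ⟨b, fun i => ?_, fun z => ?_⟩
  · refine Fin.cases ?_ (fun i => ?_) i
    · rw [hb0, hv]
    · rw [hbs, Module.Basis.unitsSMul_apply, Units.smul_mk0]
      simp only [Submodule.coe_smul, norm_smul, norm_inv, norm_norm]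
      exact inv_mul_cancel₀ (hc i)
  · have hz : φ z = b.repr z 0 := by
      conv_lhs => rw [← b.sum_repr z, map_sum, Fin.sum_univ_succ]
      have : ∀ i : Fin n, φ (b i.succ) = 0 := fun i => by
        rw [hbs]; exact (c' i).2
      simp [this, hb0, hφv]
    rw [← hz, ← Real.norm_eq_abs]
    exact (φ.le_of_opNorm_le hφ1 z).trans (by rw [one_mul])

section Cylinder

variable {E : Type*} [NormedAddCommGroup E] [NormedSpace ℝ E] {n : ℕ}
  (b : Module.Basis (Fin (n + 1)) ℝ E)

lemma thinCylinder_eq_preimage (L ε : ℝ) :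
    thinCylinder b L ε = b.equivFunL ⁻¹' Icc 0 (Fin.cons L fun _ => ε * L) := by
  ext z
  constructor
  · rintro ⟨h0, h⟩
    refine ⟨fun i => ?_, fun i => ?_⟩
    · rcases eq_or_ne i 0 with rfl | hi
      · exact h0.1
      · exact (h i hi).1
    · refine Fin.cases h0.2 (fun j => (h j.succ (Fin.succ_ne_zero j)).2) i
  · rintro ⟨h0, h1⟩
    refine ⟨⟨h0 0, h1 0⟩, fun i hi => ⟨h0 i, ?_⟩⟩
    obtain ⟨j, rfl⟩ := Fin.exists_succ_eq.2 hi
    exact h1 j.succ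

lemma isCompact_thinCylinder (L ε : ℝ) : IsCompact (thinCylinder b L ε) := by
  rw [thinCylinder_eq_preimage]
  exact b.equivFunL.toHomeomorph.isCompact_preimage.2 isCompact_Icc

lemma convex_thinCylinder (L ε : ℝ) : Convex ℝ (thinCylinder b L ε) := by
  rw [thinCylinder_eq_preimage]
  exact (convex_Icc _ _).linear_preimage b.equivFunL.toLinearEquiv.toLinearMap

lemma continuous_repr_apply (i : Fin (n + 1)) : Continuous fun z => b.repr z i :=
  (continuous_apply i).comp b.equivFunL.continuous

lemma interior_thinCylinder_nonempty {L ε : ℝ} (hL : 0 < L) (hε : 0 < ε) :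
    (interior (thinCylinder b L ε)).Nonempty := by
  set a : Fin (n + 1) → ℝ := Fin.cons L fun _ => ε * L with ha
  have ha0 : ∀ i, 0 < a i := fun i => by
    refine Fin.cases ?_ (fun j => ?_) i
    · simpa [ha] using hL
    · simpa [ha] using mul_pos hε hL
  have hopen : IsOpen (b.equivFunL ⁻¹' univ.pi fun i => Ioo 0 (a i)) :=
    (isOpen_set_pi finite_univ fun _ _ => isOpen_Ioo).preimage b.equivFunL.continuous
  have hsub : b.equivFunL ⁻¹' univ.pi (fun i => Ioo 0 (a i)) ⊆ thinCylinder b L ε := by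
    rw [thinCylinder_eq_preimage]
    exact preimage_mono fun y hy => ⟨fun i => (hy i trivial).1.le, fun i => (hy i trivial).2.le⟩
  refine ⟨b.equivFunL.symm fun i => a i / 2, interior_maximal hsub hopen ?_⟩
  intro i _
  rw [ContinuousLinearEquiv.apply_symm_apply]
  have := ha0 i
  exact ⟨by linarith, by linarith⟩

lemma thinCylinder_eq_smul {L : ℝ} (hL : 0 < L) (ε : ℝ) :
    thinCylinder b L ε = L • thinCylinder b 1 ε := by
  ext z
  rw [mem_smul_set_iff_inv_smul_mem₀ hL.ne']
  have h : ∀ i, b.repr (L⁻¹ • z) i = b.repr z i / L := fun i => by simp; ring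
  have h1 : ∀ u a : ℝ, u / L ∈ Icc 0 a ↔ u ∈ Icc 0 (a * L) := fun u a => by
    simp only [mem_Icc, div_le_iff₀ hL, le_div_iff₀ hL, zero_mul]
  change (_ ∧ _) ↔ (_ ∧ _)
  simp only [h, h1, one_mul, mul_one]

lemma diam_thinCylinder {L : ℝ} (hL : 0 < L) (ε : ℝ) :
    Metric.diam (thinCylinder b L ε) = L * Metric.diam (thinCylinder b 1 ε) := by
  rw [thinCylinder_eq_smul b hL, diam_smul₀, Real.norm_of_nonneg hL.le]

lemma one_le_diam_thinCylinder (hb : ∀ i, ‖b i‖ = 1) {ε : ℝ} (hε : 0 < ε) :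
    1 ≤ Metric.diam (thinCylinder b 1 ε) := by
  have h0 : (0 : E) ∈ thinCylinder b 1 ε := by
    refine ⟨by simp, fun i _ => by simp [hε.le]⟩
  have h1 : b 0 ∈ thinCylinder b 1 ε := by
    refine ⟨by simp, fun i hi => by simp [hi.symm, hε.le]⟩
  have := Metric.dist_le_diam_of_mem (isCompact_thinCylinder b 1 ε).isBounded h1 h0
  rwa [dist_zero_right, hb] at this

lemma diam_thinCylinder_le (hb : ∀ i, ‖b i‖ = 1) {ε : ℝ} (hε : 0 < ε) :
    Metric.diam (thinCylinder b 1 ε) ≤ 1 + n * ε := by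
  refine Metric.diam_le_of_forall_dist_le (by positivity) fun z hz w hw => ?_
  rw [dist_eq_norm, ← b.sum_repr (z - w)]
  refine (norm_sum_le _ _).trans ?_
  simp only [norm_smul, hb, mul_one, Real.norm_eq_abs, map_sub, Finsupp.sub_apply]
  rw [Fin.sum_univ_succ]
  have h1 : ∀ {a u v : ℝ}, u ∈ Icc 0 a → v ∈ Icc 0 a → |u - v| ≤ a := fun hu hv =>
    abs_le.2 ⟨by linarith [hu.1, hv.2], by linarith [hu.2, hv.1]⟩
  refine add_le_add (h1 hz.1 hw.1) ?_
  calc _ ≤ ∑ _i : Fin n, ε := Finset.sum_le_sum fun i _ => by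
        have := h1 (hz.2 i.succ (Fin.succ_ne_zero i)) (hw.2 i.succ (Fin.succ_ne_zero i))
        rwa [mul_one] at this
    _ = n * ε := by simp

lemma isCompact_cylinderSlice (L ε s : ℝ) : IsCompact (cylinderSlice b L ε s) :=
  (isCompact_thinCylinder b L ε).inter_right
    (isClosed_le (continuous_repr_apply b 0) continuous_const)

/-- Because the axis is normed by its coordinate functional, enlarging the slice by `h` inside the
cylinder moves the cutting hyperplane by exactly `h`. -/
lemma cthickening_cylinderSlice_sdiff_inter (hb : ∀ i, ‖b i‖ = 1) (hb0 : ∀ z, |b.repr z 0| ≤ ‖z‖)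
    {L ε s h : ℝ} (hs : 0 ≤ s) (hh : 0 ≤ h) :
    (Metric.cthickening h (cylinderSlice b L ε s) \ cylinderSlice b L ε s) ∩ thinCylinder b L ε =
      {z ∈ thinCylinder b L ε | b.repr z 0 ∈ Ioc s (s + h)} := by
  ext z
  constructor
  · rintro ⟨⟨hz, hzS⟩, hzK⟩
    refine ⟨hzK, ?_, ?_⟩
    · by_contra hle
      exact hzS ⟨hzK, not_lt.1 hle⟩
    · rw [(isCompact_cylinderSlice b L ε s).cthickening_eq_biUnion_closedBall hh] at hz
      simp only [mem_iUnion, Metric.mem_closedBall, exists_prop] at hz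
      obtain ⟨w, hw, hzw⟩ := hz
      have h1 := (le_abs_self _).trans (hb0 (z - w))
      rw [map_sub, Finsupp.sub_apply, ← dist_eq_norm] at h1
      have h2 : b.repr w 0 ≤ s := hw.2
      linarith
  · rintro ⟨hzK, hz1, hz2⟩
    refine ⟨⟨?_, fun h => absurd h.2 hz1.not_ge⟩, hzK⟩
    set w := z - (b.repr z 0 - s) • b 0 with hw
    have hw0 : b.repr w 0 = s := by simp [hw]
    have hwi : ∀ i, i ≠ 0 → b.repr w i = b.repr z i := fun i hi => by
      simp [hw, hi.symm]
    refine Metric.mem_cthickening_of_dist_le z w h _ ⟨⟨?_, fun i hi => ?_⟩, hw0.le⟩ ?_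
    · rw [hw0]; exact ⟨hs, hz1.le.trans hzK.1.2⟩
    · rw [hwi i hi]; exact hzK.2 i hi
    · have : z - w = (b.repr z 0 - s) • b 0 := by rw [hw]; abel
      rw [dist_eq_norm, this, norm_smul, hb, mul_one, Real.norm_of_nonneg (by linarith)]
      linarith

/-! ### The exponential density on a thin cylinder -/

variable [MeasurableSpace E] [BorelSpace E]

lemma map_volume_equivFunL_symm : volume.map b.equivFunL.symm = b.addHaar := by
  have h1 : (Pi.basisFun ℝ (Fin (n + 1))).addHaar = volume := by
    rw [Module.Basis.addHaar_def, Module.Basis.parallelepiped_basisFun, addHaarMeasure_eq_volume_pi]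
  have := b.finiteDimensional_of_finite
  have := FiniteDimensional.proper ℝ E
  rw [← h1, Module.Basis.map_addHaar]
  congr 1
  ext i
  rw [Module.Basis.map_apply, Pi.basisFun_apply]
  change b.equivFun.symm (Pi.single i 1) = b i
  rw [Module.Basis.equivFun_symm_apply]
  simp [Pi.single_apply]

/-- The density of the cylinder measure in the coordinates of the basis. -/
noncomputable def cylinderDensity (L ε γ : ℝ) (y : Fin (n + 1) → ℝ) : ℝ≥0∞ :=
  (Icc 0 (Fin.cons L fun _ => ε * L)).indicator (fun y => ENNReal.ofReal
    (Real.exp (γ * y 0 / L) /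
      ∫ z in thinCylinder b L ε, Real.exp (γ * b.repr z 0 / L) ∂b.addHaar)) y

lemma measurable_cylinderDensity (L ε γ : ℝ) : Measurable (cylinderDensity b L ε γ) := by
  refine Measurable.indicator ?_ measurableSet_Icc
  fun_prop

lemma cylinderMeasure_eq_map (L ε γ : ℝ) : cylinderMeasure b L ε γ =
    (volume.withDensity (cylinderDensity b L ε γ)).map b.equivFunL.symm := by
  have hm : Measurable b.equivFunL.symm := b.equivFunL.symm.continuous.measurable
  have hc := (isCompact_thinCylinder b L ε).measurableSet
  have hr := (continuous_repr_apply b 0).measurable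
  ext s hs
  rw [Measure.map_apply hm hs, withDensity_apply _ (hm hs), cylinderMeasure, tilted_apply' _ _ hs,
    Measure.restrict_restrict hs, ← lintegral_indicator (hs.inter hc),
    ← lintegral_indicator (hm hs)]
  conv_lhs => rw [← map_volume_equivFunL_symm]
  rw [lintegral_map _ hm]
  · refine lintegral_congr fun y => ?_
    rw [map_volume_equivFunL_symm]
    have hmem : b.equivFunL.symm y ∈ thinCylinder b L ε ↔
        y ∈ Icc 0 (Fin.cons L fun _ => ε * L) := by
      rw [thinCylinder_eq_preimage, mem_preimage, ContinuousLinearEquiv.apply_symm_apply]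
    have h0 : b.repr (b.equivFunL.symm y) 0 = y 0 :=
      congrFun (b.equivFunL.apply_symm_apply y) 0
    by_cases h1 : b.equivFunL.symm y ∈ s
    · by_cases h2 : b.equivFunL.symm y ∈ thinCylinder b L ε
      · rw [indicator_of_mem (mem_inter h1 h2), indicator_of_mem (mem_preimage.2 h1),
          cylinderDensity, indicator_of_mem (hmem.1 h2), h0]
      · rw [indicator_of_notMem (fun h => h2 h.2), indicator_of_mem (mem_preimage.2 h1),
          cylinderDensity, indicator_of_notMem (fun h => h2 (hmem.2 h))]
    · rw [indicator_of_notMem (fun h => h1 h.1),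
        indicator_of_notMem (fun h => h1 (mem_preimage.1 h))]
  · refine Measurable.indicator ?_ (hs.inter hc)
    fun_prop

lemma integrable_exp_restrict_thinCylinder (L ε γ : ℝ) :
    Integrable (fun z => Real.exp (γ * b.repr z 0 / L))
      (b.addHaar.restrict (thinCylinder b L ε)) := by
  have := continuous_repr_apply b 0
  exact (Continuous.continuousOn (by fun_prop)).integrableOn_compact (isCompact_thinCylinder b L ε)

lemma isProbabilityMeasure_cylinderMeasure {L ε : ℝ} (hL : 0 < L) (hε : 0 < ε) (γ : ℝ) :
    IsProbabilityMeasure (cylinderMeasure b L ε γ) := by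
  have : NeZero (b.addHaar.restrict (thinCylinder b L ε)) := ⟨by
    rw [Ne, Measure.restrict_eq_zero]
    exact (Measure.measure_pos_of_nonempty_interior _ (interior_thinCylinder_nonempty b hL hε)).ne'⟩
  exact isProbabilityMeasure_tilted (integrable_exp_restrict_thinCylinder b L ε γ)

lemma cylinderMeasure_compl (L ε γ : ℝ) :
    cylinderMeasure b L ε γ (thinCylinder b L ε)ᶜ = 0 := by
  refine tilted_absolutelyContinuous _ _ ?_
  rw [Measure.restrict_apply' (isCompact_thinCylinder b L ε).measurableSet]
  simp

lemma isLogConcaveMeasure_cylinderMeasure {L ε : ℝ} (hL : 0 < L) (hε : 0 < ε) (γ : ℝ) :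
    IsLogConcaveMeasure (cylinderMeasure b L ε γ) := by
  have hp := isProbabilityMeasure_cylinderMeasure b hL hε γ
  rw [cylinderMeasure_eq_map] at hp ⊢
  have hm : Measurable b.equivFunL.symm := b.equivFunL.symm.continuous.measurable
  have hf : IsFiniteMeasure (volume.withDensity (cylinderDensity b L ε γ)) := ⟨by
    have := measure_univ (μ := (volume.withDensity (cylinderDensity b L ε γ)).map b.equivFunL.symm)
    rw [Measure.map_apply hm MeasurableSet.univ, preimage_univ] at this
    rw [this]; exact ENNReal.one_lt_top⟩
  refine (isLogConcaveMeasure_withDensity (measurable_cylinderDensity b L ε γ) ?_).map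
    b.equivFunL.symm.toLinearEquiv.toLinearMap hm
  intro t ht x y
  have ht0 := ht.1
  have ht1 : 0 < 1 - t := by linarith [ht.2]
  have := b.finiteDimensional_of_finite
  have : NeZero (b.addHaar.restrict (thinCylinder b L ε)) := ⟨by
    rw [Ne, Measure.restrict_eq_zero]
    exact (Measure.measure_pos_of_nonempty_interior _ (interior_thinCylinder_nonempty b hL hε)).ne'⟩
  have hZ : 0 < ∫ z in thinCylinder b L ε, Real.exp (γ * b.repr z 0 / L) ∂b.addHaar :=
    integral_exp_pos (integrable_exp_restrict_thinCylinder b L ε γ)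
  unfold cylinderDensity
  set Z := ∫ z in thinCylinder b L ε, Real.exp (γ * b.repr z 0 / L) ∂b.addHaar
  set Q : Set (Fin (n + 1) → ℝ) := Icc 0 (Fin.cons L fun _ => ε * L)
  have hexp : ∀ u : ℝ, Real.exp u / Z = Real.exp (u - Real.log Z) := fun u => by
    rw [Real.exp_sub, Real.exp_log hZ]
  by_cases hx : x ∈ Q
  · by_cases hy : y ∈ Q
    · rw [indicator_of_mem hx, indicator_of_mem hy,
        indicator_of_mem (convex_Icc _ _ hx hy ht0.le ht1.le (by ring)), hexp, hexp, hexp,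
        ENNReal.ofReal_rpow_of_pos (Real.exp_pos _), ENNReal.ofReal_rpow_of_pos (Real.exp_pos _),
        ← Real.exp_mul, ← Real.exp_mul, ← ENNReal.ofReal_mul (Real.exp_pos _).le, ← Real.exp_add]
      refine le_of_eq (congrArg _ (congrArg _ ?_))
      simp only [Pi.add_apply, Pi.smul_apply, smul_eq_mul]
      ring
    · rw [indicator_of_notMem hy, ENNReal.zero_rpow_of_pos ht1, mul_zero]; exact zero_le
  · rw [indicator_of_notMem hx, ENNReal.zero_rpow_of_pos ht0, zero_mul]; exact zero_le

/-- The law of the axial coordinate under the cylinder measure is proportional to `e^(γ u / L) du`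
on `[0, L]`. -/
lemma exists_cylinderMeasure_slab (L ε γ : ℝ) : ∃ κ : ℝ≥0∞, ∀ B : Set ℝ, MeasurableSet B →
    B ⊆ Icc 0 L → cylinderMeasure b L ε γ {z ∈ thinCylinder b L ε | b.repr z 0 ∈ B} =
      κ * ∫⁻ u in B, ENNReal.ofReal (Real.exp (γ * u / L)) := by
  have hm : Measurable b.equivFunL.symm := b.equivFunL.symm.continuous.measurable
  set Z := ∫ z in thinCylinder b L ε, Real.exp (γ * b.repr z 0 / L) ∂b.addHaar with hZ
  have hZ0 : 0 ≤ Z := integral_nonneg fun _ => (Real.exp_pos _).le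
  set R : Set (Fin n → ℝ) := Icc 0 fun _ => ε * L with hR
  have hRm : MeasurableSet R := measurableSet_Icc
  refine ⟨ENNReal.ofReal Z⁻¹ * volume R, fun B hB hBL => ?_⟩
  have hAm : MeasurableSet {z ∈ thinCylinder b L ε | b.repr z 0 ∈ B} :=
    (isCompact_thinCylinder b L ε).measurableSet.inter
      ((continuous_repr_apply b 0).measurable hB)
  rw [cylinderMeasure_eq_map, Measure.map_apply hm hAm, withDensity_apply _ (hm hAm),
    ← lintegral_indicator (hm hAm), lintegral_finCons
      ((measurable_cylinderDensity b L ε γ).indicator (hm hAm)), ← lintegral_indicator hB,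
    ← lintegral_const_mul _ (Measurable.indicator (by fun_prop) hB)]
  refine lintegral_congr fun u => ?_
  have hpt : ∀ y : Fin n → ℝ,
      (b.equivFunL.symm ⁻¹' {z ∈ thinCylinder b L ε | b.repr z 0 ∈ B}).indicator
        (cylinderDensity b L ε γ) (Fin.cons u y) =
      R.indicator (fun _ => ENNReal.ofReal Z⁻¹ *
        B.indicator (fun u => ENNReal.ofReal (Real.exp (γ * u / L))) u) y := by
    intro y
    have h0 : b.repr (b.equivFunL.symm (Fin.cons u y)) 0 = u :=
      congrFun (b.equivFunL.apply_symm_apply (Fin.cons u y : Fin (n + 1) → ℝ)) 0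
    have hQ : (Fin.cons u y : Fin (n + 1) → ℝ) ∈ Icc (0 : Fin (n + 1) → ℝ)
        (Fin.cons L fun _ => ε * L) ↔ u ∈ Icc 0 L ∧ y ∈ R := by
      simp only [hR, mem_Icc, Pi.le_def, Fin.forall_fin_succ, Fin.cons_zero, Fin.cons_succ,
        Pi.zero_apply]
      tauto
    have hmem : (Fin.cons u y : Fin (n + 1) → ℝ) ∈
        b.equivFunL.symm ⁻¹' {z ∈ thinCylinder b L ε | b.repr z 0 ∈ B} ↔ u ∈ B ∧ y ∈ R := by
      rw [mem_preimage, mem_sep_iff, h0, thinCylinder_eq_preimage, mem_preimage,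
        ContinuousLinearEquiv.apply_symm_apply, hQ]
      exact ⟨fun h => ⟨h.2, h.1.2⟩, fun h => ⟨⟨hBL h.1, h.2⟩, h.1⟩⟩
    by_cases hu : u ∈ B
    · by_cases hy : y ∈ R
      · rw [indicator_of_mem (hmem.2 ⟨hu, hy⟩), indicator_of_mem hy, indicator_of_mem hu,
          cylinderDensity, indicator_of_mem (hQ.2 ⟨hBL hu, hy⟩), Fin.cons_zero,
          ← ENNReal.ofReal_mul (inv_nonneg.2 hZ0), ← hZ, div_eq_inv_mul]
      · rw [indicator_of_notMem (fun h => hy (hmem.1 h).2), indicator_of_notMem hy]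
    · rw [indicator_of_notMem (fun h => hu (hmem.1 h).1)]
      simp [hu]
  simp only [hpt]
  rw [lintegral_indicator hRm, setLIntegral_const]
  ring

lemma continuous_exp_mul_div (γ L : ℝ) : Continuous fun u : ℝ => Real.exp (γ * u / L) := by
  fun_prop

lemma setLIntegral_ofReal_exp {γ L c d : ℝ} (hcd : c ≤ d) :
    ∫⁻ u in Ioc c d, ENNReal.ofReal (Real.exp (γ * u / L)) =
      ENNReal.ofReal (∫ u in c..d, Real.exp (γ * u / L)) := by
  rw [intervalIntegral.integral_of_le hcd, ofReal_integral_eq_lintegral_ofReal]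
  · exact ((continuous_exp_mul_div γ L).continuousOn.integrableOn_compact isCompact_Icc).mono_set
      Ioc_subset_Icc_self
  · exact Eventually.of_forall fun _ => (Real.exp_pos _).le

lemma integral_exp_mul_div_pos {γ L d : ℝ} (hd : 0 < d) :
    0 < ∫ u in (0 : ℝ)..d, Real.exp (γ * u / L) :=
  intervalIntegral.intervalIntegral_pos_of_pos
    ((continuous_exp_mul_div γ L).intervalIntegrable _ _) (fun _ => Real.exp_pos _) hd

lemma cylinderMeasure_Ioc {L ε : ℝ} (hL : 0 < L) (hε : 0 < ε) (γ : ℝ) {c d : ℝ} (hc : 0 ≤ c)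
    (hcd : c ≤ d) (hd : d ≤ L) :
    cylinderMeasure b L ε γ {z ∈ thinCylinder b L ε | b.repr z 0 ∈ Ioc c d} =
      ENNReal.ofReal ((∫ u in c..d, Real.exp (γ * u / L)) /
        ∫ u in (0 : ℝ)..L, Real.exp (γ * u / L)) := by
  obtain ⟨κ, hκ⟩ := exists_cylinderMeasure_slab b L ε γ
  have hp := isProbabilityMeasure_cylinderMeasure b hL hε γ
  have hW := integral_exp_mul_div_pos (γ := γ) (L := L) hL
  have h1 : κ * ENNReal.ofReal (∫ u in (0 : ℝ)..L, Real.exp (γ * u / L)) = 1 := by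
    rw [← setLIntegral_ofReal_exp hL.le, setLIntegral_congr Ioc_ae_eq_Icc,
      ← hκ _ measurableSet_Icc Subset.rfl]
    have : {z ∈ thinCylinder b L ε | b.repr z 0 ∈ Icc 0 L} = thinCylinder b L ε := by
      ext z; exact ⟨fun h => h.1, fun h => ⟨h, h.1⟩⟩
    rw [this]
    exact (prob_compl_eq_zero_iff (isCompact_thinCylinder b L ε).measurableSet).1
      (cylinderMeasure_compl b L ε γ)
  rw [hκ _ measurableSet_Ioc (fun u hu => ⟨hc.trans hu.1.le, hu.2.trans hd⟩),
    setLIntegral_ofReal_exp hcd, ENNReal.ofReal_div_of_pos hW, div_eq_mul_inv, mul_comm,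
    ENNReal.eq_inv_of_mul_eq_one_left h1]

lemma cylinderMeasure_slice {L ε : ℝ} (hL : 0 < L) (hε : 0 < ε) (γ : ℝ) {s : ℝ} (hs : 0 ≤ s)
    (hsL : s ≤ L) : cylinderMeasure b L ε γ (cylinderSlice b L ε s) =
      ENNReal.ofReal ((∫ u in (0 : ℝ)..s, Real.exp (γ * u / L)) /
        ∫ u in (0 : ℝ)..L, Real.exp (γ * u / L)) := by
  rw [← cylinderMeasure_Ioc b hL hε γ le_rfl hs hsL]
  obtain ⟨κ, hκ⟩ := exists_cylinderMeasure_slab b L ε γ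
  have h : cylinderSlice b L ε s = {z ∈ thinCylinder b L ε | b.repr z 0 ∈ Icc 0 s} := by
    ext z
    exact ⟨fun h => ⟨h.1, h.1.1.1, h.2⟩, fun h => ⟨h.1, h.2.2⟩⟩
  rw [h, hκ _ measurableSet_Icc (Icc_subset_Icc_right hsL),
    hκ _ measurableSet_Ioc (Ioc_subset_Icc_self.trans (Icc_subset_Icc_right hsL)),
    setLIntegral_congr Ioc_ae_eq_Icc]

lemma tendsto_minkowskiQuotient_cylinder (hb : ∀ i, ‖b i‖ = 1) (hb0 : ∀ z, |b.repr z 0| ≤ ‖z‖)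
    {L ε : ℝ} (hL : 0 < L) (hε : 0 < ε) (γ : ℝ) {s : ℝ} (hs : s ∈ Ioo 0 L) :
    Tendsto (minkowskiQuotient (cylinderMeasure b L ε γ) (cylinderSlice b L ε s)) (𝓝[>] 0)
      (𝓝 (ENNReal.ofReal (Real.exp (γ * s / L) / ∫ u in (0 : ℝ)..L, Real.exp (γ * u / L)))) := by
  set W := ∫ u in (0 : ℝ)..L, Real.exp (γ * u / L) with hW
  have hd : HasDerivAt (fun d => ∫ u in (0 : ℝ)..d, Real.exp (γ * u / L))
      (Real.exp (γ * s / L)) s :=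
    intervalIntegral.integral_hasDerivAt_right ((continuous_exp_mul_div γ L).intervalIntegrable _ _)
      ((continuous_exp_mul_div γ L).stronglyMeasurableAtFilter _ _)
      (continuous_exp_mul_div γ L).continuousAt
  have hlim := ((hasDerivAt_iff_tendsto_slope_zero.1 hd).mono_left
    (nhdsWithin_mono 0 (fun h (hh : 0 < h) => hh.ne' : Ioi (0 : ℝ) ⊆ {0}ᶜ))).div_const W
  refine ((ENNReal.continuous_ofReal.tendsto _).comp hlim).congr' ?_
  filter_upwards [Ioo_mem_nhdsGT (sub_pos.2 hs.2)] with h hh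
  have hnull : cylinderMeasure b L ε γ
      (Metric.cthickening h (cylinderSlice b L ε s) \ cylinderSlice b L ε s) =
      cylinderMeasure b L ε γ {z ∈ thinCylinder b L ε | b.repr z 0 ∈ Ioc s (s + h)} := by
    rw [← cthickening_cylinderSlice_sdiff_inter b hb hb0 hs.1.le hh.1.le,
      measure_inter_conull (cylinderMeasure_compl b L ε γ)]
  rw [minkowskiQuotient, hnull, cylinderMeasure_Ioc b hL hε γ hs.1.le (by linarith [hh.1])
    (by linarith [hh.2]), ← ENNReal.ofReal_div_of_pos hh.1, Function.comp_apply, smul_eq_mul,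
    intervalIntegral.integral_interval_sub_left
      ((continuous_exp_mul_div γ L).intervalIntegrable _ _)
      ((continuous_exp_mul_div γ L).intervalIntegrable _ _)]
  congr 1
  ring

end Cylinder

/-! ### Sharpness -/

lemma mul_integral_exp {γ L : ℝ} (hL : 0 < L) (d : ℝ) :
    γ * ∫ u in (0 : ℝ)..d, Real.exp (γ * u / L) = L * (Real.exp (γ * d / L) - 1) := by
  rw [← intervalIntegral.integral_const_mul]
  have hd : ∀ u ∈ uIcc 0 d, HasDerivAt (fun u => L * Real.exp (γ * u / L))
      (γ * Real.exp (γ * u / L)) u := fun u _ => by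
    have h := ((((hasDerivAt_id u).const_mul γ).div_const L).exp).const_mul L
    refine HasDerivAt.congr_deriv h ?_
    simp only [id, mul_one]
    field_simp
  rw [intervalIntegral.integral_eq_sub_of_hasDerivAt hd
    (((continuous_exp_mul_div γ L).const_mul γ).intervalIntegrable _ _)]
  simp; ring

/-- The quantile of order `x` of the exponential distribution on `[0, L]` with parameter `γ(x)`,
and the density there. -/
lemma exists_quantile {x : ℝ} (hx : x ∈ Ioc (0 : ℝ) (1 / 2)) {L : ℝ} (hL : 0 < L) :
    ∃ s ∈ Ioo 0 L,
      (∫ u in (0 : ℝ)..s, Real.exp (isoGamma x * u / L)) /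
        (∫ u in (0 : ℝ)..L, Real.exp (isoGamma x * u / L)) = x ∧
      L * (Real.exp (isoGamma x * s / L) / ∫ u in (0 : ℝ)..L, Real.exp (isoGamma x * u / L)) =
        x * isoG (1 / x) := by
  set γ := isoGamma x with hγ
  set P : ℝ → ℝ := fun d => ∫ u in (0 : ℝ)..d, Real.exp (γ * u / L) with hP
  have hW : 0 < P L := integral_exp_mul_div_pos hL
  have hPc : Continuous P := intervalIntegral.continuous_primitive
    (fun _ _ => (continuous_exp_mul_div γ L).intervalIntegrable _ _) 0
  have hP0 : P 0 = 0 := intervalIntegral.integral_same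
  obtain ⟨s, hs, hsx⟩ : x * P L ∈ P '' Ioo 0 L := by
    refine intermediate_value_Ioo hL.le hPc.continuousOn ⟨?_, ?_⟩
    · rw [hP0]; exact mul_pos hx.1 hW
    · nlinarith [hx.2]
  refine ⟨s, hs, ?_, ?_⟩
  · change P s / P L = x
    rw [hsx]; field_simp
  change L * (Real.exp (γ * s / L) / P L) = _
  have e1 : γ * P s = L * (Real.exp (γ * s / L) - 1) := mul_integral_exp hL s
  have e2 : γ * P L = L * (Real.exp (γ * L / L) - 1) := mul_integral_exp hL L
  rw [mul_div_assoc, div_self hL.ne', mul_one] at e2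
  rcases hx.2.lt_or_eq with hlt | heq
  · rw [mul_isoG_eq ⟨hx.1, hlt⟩, ← hγ]
    have hγ0 : 0 < γ := (isoGamma_spec ⟨hx.1, hlt⟩).1
    have h1 : 0 < Real.exp γ - 1 := by
      have := Real.add_one_lt_exp hγ0.ne'; linarith
    have e3 : Real.exp (γ * s / L) = 1 + x * (Real.exp γ - 1) := by
      rw [hsx] at e1
      have : L * (Real.exp (γ * s / L) - 1) = L * (x * (Real.exp γ - 1)) := by
        rw [← e1]; linear_combination x * e2
      linarith [mul_left_cancel₀ hL.ne' this]
    have e4 : P L = L * (Real.exp γ - 1) / γ := by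
      rw [eq_div_iff hγ0.ne', mul_comm]; exact e2
    rw [e3, e4]
    field_simp
    ring
  · have hγ0 : γ = 0 := by rw [hγ, isoGamma, if_pos heq]
    rw [heq, half_mul_isoG]
    have : P L = L := by simp [hP, hγ0]
    rw [this, hγ0]
    simp [hL.ne']

theorem theorem1 {E : Type*} [NormedAddCommGroup E] [NormedSpace ℝ E] [FiniteDimensional ℝ E]
    [MeasurableSpace E] [BorelSpace E] :
    -- the parameter in the definition of `G` is well defined
    (∀ x ∈ Ioo (0 : ℝ) (1 / 2), ∃! γ : ℝ, 0 < γ ∧ x = isoParam γ) ∧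
    -- the isoperimetric inequality
    (∀ (K : Set E) (μ : Measure E), IsCompact K → Convex ℝ K → IsProbabilityMeasure μ →
      IsLogConcaveMeasure μ → μ Kᶜ = 0 →
      ∀ S : Set E, S ⊆ K → NullMeasurableSet S μ → μ S ≤ 1 / 2 →
        ENNReal.ofReal (μ.real S * isoG (1 / μ.real S)) ≤
          ENNReal.ofReal (Metric.diam K) * minkowskiMeasure μ S) ∧
    -- sharpness, for every dimension `n + 1 ≥ 1`, set size `x` and diameter `D`, the given norm
    -- being arbitrary; the near-extremal examples are thin cylinders with exponential density
    (∀ n : ℕ, Module.finrank ℝ E = n + 1 →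
      ∃ b : Module.Basis (Fin (n + 1)) ℝ E, (∀ i, ‖b i‖ = 1) ∧
        ∀ x ∈ Ioc (0 : ℝ) (1 / 2), ∀ D > (0 : ℝ), ∀ δ > (0 : ℝ),
          ∃ ε ∈ Ioo 0 δ, ∃ L > (0 : ℝ), ∃ s ∈ Ioo 0 L, ∃ m : ℝ,
            IsCompact (thinCylinder b L ε) ∧ Convex ℝ (thinCylinder b L ε) ∧
            (interior (thinCylinder b L ε)).Nonempty ∧
            Metric.diam (thinCylinder b L ε) = D ∧
            IsProbabilityMeasure (cylinderMeasure b L ε (isoGamma x)) ∧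
            IsLogConcaveMeasure (cylinderMeasure b L ε (isoGamma x)) ∧
            cylinderMeasure b L ε (isoGamma x) (thinCylinder b L ε)ᶜ = 0 ∧
            MeasurableSet (cylinderSlice b L ε s) ∧
            cylinderMeasure b L ε (isoGamma x) (cylinderSlice b L ε s) = ENNReal.ofReal x ∧
            Tendsto (minkowskiQuotient (cylinderMeasure b L ε (isoGamma x))
              (cylinderSlice b L ε s)) (𝓝[>] 0) (𝓝 (ENNReal.ofReal m)) ∧
            0 ≤ m ∧ D * m ≤ x * isoG (1 / x) + δ) := by
  refine ⟨fun x hx => ?_, fun K μ hKc hKv hμp hμ hμK S hSK hS hS1 =>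
    mul_isoG_le_minkowskiMeasure hμ hKc hKv hμK hS hSK hS1, fun n hn => ?_⟩
  · obtain ⟨γ, hγ0, hγ⟩ := exists_isoParam_eq hx
    exact ⟨γ, ⟨hγ0, hγ.symm⟩, fun γ' h => strictAntiOn_isoParam.injOn h.1 hγ0 (by rw [← h.2, hγ])⟩
  obtain ⟨b, hb, hb0⟩ := exists_unit_basis_abs_repr_zero_le hn
  refine ⟨b, hb, fun x hx D hD δ hδ => ?_⟩
  -- The diameter exceeds the length `L` by a factor of at most `1 + n ε`.
  obtain ⟨ε, hε0, hεδ, hnε⟩ : ∃ ε > 0, ε < δ ∧ n * ε ≤ δ := by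
    refine ⟨δ / (n + 2), by positivity, div_lt_self hδ (by linarith [n.cast_nonneg (α := ℝ)]), ?_⟩
    rw [mul_div_assoc', div_le_iff₀ (by positivity)]
    nlinarith
  have hd1 := one_le_diam_thinCylinder b hb hε0
  have hd2 := diam_thinCylinder_le b hb hε0
  set d := Metric.diam (thinCylinder b 1 ε) with hd
  have hd0 : 0 < d := by linarith
  have hL : 0 < D / d := by positivity
  obtain ⟨s, hs, hsx, hsm⟩ := exists_quantile hx hL
  have hm0 : 0 ≤ Real.exp (isoGamma x * s / (D / d)) /
      ∫ u in (0 : ℝ)..D / d, Real.exp (isoGamma x * u / (D / d)) :=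
    div_nonneg (Real.exp_pos _).le (integral_exp_mul_div_pos hL).le
  refine ⟨ε, ⟨hε0, hεδ⟩, D / d, hL, s, hs, _, isCompact_thinCylinder b _ _,
    convex_thinCylinder b _ _, interior_thinCylinder_nonempty b hL hε0, ?_,
    isProbabilityMeasure_cylinderMeasure b hL hε0 _, isLogConcaveMeasure_cylinderMeasure b hL hε0 _,
    cylinderMeasure_compl b _ _ _, (isCompact_cylinderSlice b _ _ _).measurableSet, ?_,
    tendsto_minkowskiQuotient_cylinder b hb hb0 hL hε0 _ hs, hm0, ?_⟩
  · rw [diam_thinCylinder b hL, ← hd]; field_simp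
  · rw [cylinderMeasure_slice b hL hε0 _ hs.1.le hs.2.le, hsx]
  · set m := Real.exp (isoGamma x * s / (D / d)) /
      ∫ u in (0 : ℝ)..D / d, Real.exp (isoGamma x * u / (D / d))
    have h1 : D * m = d * (x * isoG (1 / x)) := by rw [← hsm]; field_simp
    have h2 := mul_isoG_le_one hx
    have h3 := mul_isoG_nonneg hx
    rw [h1]
    nlinarith [mul_le_mul hd2 (le_refl (x * isoG (1 / x))) h3 (by positivity),
      mul_nonneg (mul_nonneg n.cast_nonneg hε0.le) (sub_nonneg.2 h2)]
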